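/- Let $\Bbbk$ be a field, let $m\ge 1$ and $1\le c\le n$ be integers, let $S=\Bbbk[x_1,\dots,x_n]$ with the standard grading, and let $$I_{n,c}^{(m)}=\bigcap_{1\le i_1<\dots<i_c\le n}(x_{i_1},\dots,x_{i_c})^m\subset S$$ be the $m$-th symbolic power of $I_{n,c}=\bigcap_{1\le i_1<\dots<i_c\le n}(x_{i_1},\dots,x_{i_c})$. For a homogeneous ideal $I\subset S$ write $\beta_{i,j}(I)=\dim_\Bbbk \operatorname{Tor}^S_i(I,\Bbbk)_j$. Row $j$ (the degree $j$ strand) of the Betti table of $I$ consists of the entries $\beta_{i,i+j}(I)$, $i\ge 0$; a nonzero row has length $l$ if $l$ is the largest $i$ with $\beta_{i,i+j}(I)\ne 0$; the top row is the nonzero row with the smallest $j$. The Castelnuovo–Mumford regularity of $I$ is $\max\{j-i:\beta_{i,j}(I)\ne 0\}$. Binomial coefficients with negative lower index are $0$. Then: 1. $\beta_{i,i+j}(I_{n,c}^{(m)})=0$ for all $i\ge 0$ and all $j\notin\{m+k(n-c): k=1,2,\dots,m\}$. 2. If $c<n$, then for all $i\ge 0$ and all integers $k\ge \frac m2+1$,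 $$\beta_{i,i+m+k(n-c)}(I_{n,c}^{(m)})=\binom{c-1}{i}\,\beta_{0,m+k(n-c)}(I_{n,c}^{(m)}).$$ 3. The Castelnuovo–Mumford regularity of $I_{n,c}^{(m)}$ is $m(1+n-c)$. Moreover, if $c<n$ and $m\ge 2$, then the bottom row of the Betti table is given by $$\beta_{i,i+m(1+n-c)}(I_{n,c}^{(m)})=\binom{n}{c-1}\binom{c-1}{i}\quad\text{for all } i\ge 0.$$ 4. If $c<n$ and $m\le c$, then the top row of the Betti table is given by $$\beta_{i,i+m+n-c}(I_{n,c}^{(m)})=\binom{n}{c-m-i}\binom{m+n-c+i-1}{i}\quad\text{for all } i\ge 0.$$ 5. Every nonzero row of the Betti table of $I_{n,c}^{(m)}$ other than the top row has length $c-1$. -/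

import Mathlib

open scoped TensorProduct

universe u v

namespace StarConfiguration

/-- The symbolic power `I_{n,c}^{(m)} = ⋂ (x_{i_1}, …, x_{i_c})^m` in `𝕜[x_1, …, x_n]`, the
intersection being over all `c`-element sets of variables. For `m = 1` this is `I_{n,c}`. -/
noncomputable def starIdeal (𝕜 : Type u) [Field 𝕜] (n c m : ℕ) :
    Ideal (MvPolynomial (Fin n) 𝕜) :=
  ⨅ s ∈ {s : Finset (Fin n) | s.card = c},
    Ideal.span ((fun i => (MvPolynomial.X i : MvPolynomial (Fin n) 𝕜)) '' (s : Set (Fin n))) ^ m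

/-- The degree `q` part of the graded free module `⨁_b S(-deg b)`, realized as `B →₀ S` with the
basis vector of index `b` placed in degree `deg b`. Here `S = 𝕜[x_1, …, x_n]` has the standard
grading. -/
def freeDegree {𝕜 : Type u} [Field 𝕜] {n : ℕ} {B : Type u} (deg : B → ℕ) (q : ℕ) :
    Submodule 𝕜 (B →₀ MvPolynomial (Fin n) 𝕜) where
  carrier := {f | ∀ b (e : Fin n →₀ ℕ), (f b).coeff e ≠ 0 → deg b + e.degree = q}
  zero_mem' := by
    intro b e h
    simp at h
  add_mem' := by
    intro f g hf hg b e h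
    by_cases hfe : (f b).coeff e = 0
    · refine hg b e fun hge => h ?_
      simp [hfe, hge]
    · exact hf b e hfe
  smul_mem' := by
    intro a f hf b e h
    refine hf b e fun hfe => h ?_
    simp [hfe]

/-- A graded free `S`-module on a basis `B` with degrees `deg`, together with a submodule `N`
(the module of syzygies still to be resolved). -/
structure Syzygies (𝕜 : Type u) [Field 𝕜] (n : ℕ) where
  B : Type u
  deg : B → ℕ
  N : Submodule (MvPolynomial (Fin n) 𝕜) (B →₀ MvPolynomial (Fin n) 𝕜)

/-- The index set of the homogeneous elements of `N` (with their degrees). -/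
abbrev Syzygies.Gen {𝕜 : Type u} [Field 𝕜] {n : ℕ} (F : Syzygies 𝕜 n) : Type u :=
  {p : ℕ × (F.B →₀ MvPolynomial (Fin n) 𝕜) // p.2 ∈ F.N ∧ p.2 ∈ freeDegree F.deg p.1}

/-- The degree-preserving map onto `N` from the graded free module on all homogeneous elements
of `N`. -/
noncomputable def Syzygies.map {𝕜 : Type u} [Field 𝕜] {n : ℕ} (F : Syzygies 𝕜 n) :
    (F.Gen →₀ MvPolynomial (Fin n) 𝕜) →ₗ[MvPolynomial (Fin n) 𝕜]
      (F.B →₀ MvPolynomial (Fin n) 𝕜) :=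
  Finsupp.linearCombination (MvPolynomial (Fin n) 𝕜) fun p : F.Gen => p.1.2

/-- One step of the resolution: cover `N` by the free module on its homogeneous elements and pass
to the kernel. -/
noncomputable abbrev Syzygies.next {𝕜 : Type u} [Field 𝕜] {n : ℕ} (F : Syzygies 𝕜 n) :
    Syzygies 𝕜 n where
  B := F.Gen
  deg := fun p => p.1.1
  N := LinearMap.ker F.map

/-- The start `S ⊇ (x_1, …, x_n)` of the resolution of the residue field
`𝕜 = S/(x_1, …, x_n)`, with `S` realized as the free module on one generator of degree `0`. -/
noncomputable abbrev residueSyzygies (𝕜 : Type u) [Field 𝕜] (n : ℕ) : Syzygies 𝕜 n where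
  B := PUnit
  deg := fun _ => 0
  N := Submodule.comap (Finsupp.lapply PUnit.unit)
    (Ideal.span (Set.range (MvPolynomial.X : Fin n → MvPolynomial (Fin n) 𝕜)))

/-- The graded free resolution `⋯ → F_2 → F_1 → F_0 = S → 𝕜 → 0` of the residue field
`𝕜 = S/(x_1, …, x_n)`. The module `N` of stage `i` is the kernel of `F_i → F_{i-1}` (of `S → 𝕜`
for `i = 0`). -/
noncomputable def resolution (𝕜 : Type u) [Field 𝕜] (n : ℕ) : ℕ → Syzygies 𝕜 n
  | 0 => residueSyzygies 𝕜 n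
  | i + 1 => (resolution 𝕜 n i).next

/-- The free module `F_i` of the resolution. -/
abbrev resObj (𝕜 : Type u) [Field 𝕜] (n i : ℕ) : Type u :=
  (resolution 𝕜 n i).B →₀ MvPolynomial (Fin n) 𝕜

/-- The differential `F_{i+1} → F_i`. -/
noncomputable def resMap (𝕜 : Type u) [Field 𝕜] (n i : ℕ) :
    resObj 𝕜 n (i + 1) →ₗ[MvPolynomial (Fin n) 𝕜] resObj 𝕜 n i :=
  (resolution 𝕜 n i).map

/-- The cycles in `M ⊗_S F_i`. -/
noncomputable def torCycles (𝕜 : Type u) [Field 𝕜] (n : ℕ) (M : Type v) [AddCommGroup M]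
    [Module (MvPolynomial (Fin n) 𝕜) M] :
    (i : ℕ) → Submodule (MvPolynomial (Fin n) 𝕜) (M ⊗[MvPolynomial (Fin n) 𝕜] resObj 𝕜 n i)
  | 0 => ⊤
  | i + 1 => LinearMap.ker ((resMap 𝕜 n i).lTensor M)

/-- The boundaries in `M ⊗_S F_i`. -/
noncomputable def torBoundaries (𝕜 : Type u) [Field 𝕜] (n : ℕ) (M : Type v) [AddCommGroup M]
    [Module (MvPolynomial (Fin n) 𝕜) M] (i : ℕ) :
    Submodule (MvPolynomial (Fin n) 𝕜) (M ⊗[MvPolynomial (Fin n) 𝕜] resObj 𝕜 n i) :=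
  LinearMap.range ((resMap 𝕜 n i).lTensor M)

/-- `Tor_i^S(M, 𝕜)`, the homology of `M ⊗_S F` for the graded free resolution `F` of `𝕜`
(as for `CategoryTheory.Tor`, it is the second argument which is resolved). -/
abbrev TorResidue (𝕜 : Type u) [Field 𝕜] (n : ℕ) (M : Type v) [AddCommGroup M]
    [Module (MvPolynomial (Fin n) 𝕜) M] (i : ℕ) : Type (max u v) :=
  torCycles 𝕜 n M i ⧸ (torBoundaries 𝕜 n M i).submoduleOf (torCycles 𝕜 n M i)

/-- The degree `j` part of `M ⊗_S F_i`, where `M` is graded by the subspaces `ℳ p`: it is spanned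
by the `x ⊗ f` with `x ∈ M` and `f ∈ F_i` homogeneous of degrees adding up to `j`. -/
noncomputable def tensorDegree {𝕜 : Type u} [Field 𝕜] {n : ℕ} {M : Type v} [AddCommGroup M]
    [Module (MvPolynomial (Fin n) 𝕜) M] [Module 𝕜 M] [IsScalarTower 𝕜 (MvPolynomial (Fin n) 𝕜) M]
    (ℳ : ℕ → Submodule 𝕜 M) (i j : ℕ) :
    Submodule 𝕜 (M ⊗[MvPolynomial (Fin n) 𝕜] resObj 𝕜 n i) :=
  Submodule.span 𝕜 {t | ∃ (p q : ℕ) (x : M) (f : resObj 𝕜 n i), p + q = j ∧ x ∈ ℳ p ∧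
    f ∈ freeDegree (resolution 𝕜 n i).deg q ∧ t = x ⊗ₜ[MvPolynomial (Fin n) 𝕜] f}

/-- `Tor_i^S(M, 𝕜)_j`, for `M` graded by the subspaces `ℳ p`: the classes of the cycles of
degree `j`. -/
noncomputable def torDegree {𝕜 : Type u} [Field 𝕜] {n : ℕ} {M : Type v} [AddCommGroup M]
    [Module (MvPolynomial (Fin n) 𝕜) M] [Module 𝕜 M] [IsScalarTower 𝕜 (MvPolynomial (Fin n) 𝕜) M]
    (ℳ : ℕ → Submodule 𝕜 M) (i j : ℕ) : Submodule 𝕜 (TorResidue 𝕜 n M i) :=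
  ((tensorDegree ℳ i j).comap ((torCycles 𝕜 n M i).subtype.restrictScalars 𝕜)).map
    (((torBoundaries 𝕜 n M i).submoduleOf (torCycles 𝕜 n M i)).mkQ.restrictScalars 𝕜)

/-- The elements of degree `p` of an ideal of `S = 𝕜[x_1, …, x_n]`. -/
noncomputable def idealDegree {𝕜 : Type u} [Field 𝕜] {n : ℕ} (I : Ideal (MvPolynomial (Fin n) 𝕜)) (p : ℕ) :
    Submodule 𝕜 I :=
  (MvPolynomial.homogeneousSubmodule (Fin n) 𝕜 p).comap (I.subtype.restrictScalars 𝕜)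

/-- The graded Betti number `β_{i,j}(I) = dim_𝕜 Tor_i^S(I, 𝕜)_j` of a homogeneous ideal `I`
of `S = 𝕜[x_1, …, x_n]`. -/
noncomputable def gradedBetti {𝕜 : Type u} [Field 𝕜] {n : ℕ}
    (I : Ideal (MvPolynomial (Fin n) 𝕜)) (i j : ℕ) : ℕ :=
  Module.finrank 𝕜 (torDegree (n := n) (M := I) (idealDegree I) i j)

/-- `r` is the Castelnuovo-Mumford regularity `max {j - i : β_{i,j}(I) ≠ 0}` of `I`. -/
def IsRegularity {𝕜 : Type u} [Field 𝕜] {n : ℕ}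
    (I : Ideal (MvPolynomial (Fin n) 𝕜)) (r : ℤ) : Prop :=
  IsGreatest {a : ℤ | ∃ i j : ℕ, gradedBetti I i j ≠ 0 ∧ a = (j : ℤ) - (i : ℤ)} r

/-- The degree `j` strand (row `j` of the Betti table, whose entry in column `i` is
`β_{i,i+j}(I)`) is nonzero. -/
def RowNonzero {𝕜 : Type u} [Field 𝕜] {n : ℕ}
    (I : Ideal (MvPolynomial (Fin n) 𝕜)) (j : ℕ) : Prop :=
  ∃ i, gradedBetti I i (i + j) ≠ 0

/-- The top row of the Betti table is the first nonzero one. -/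
def IsTopRow {𝕜 : Type u} [Field 𝕜] {n : ℕ}
    (I : Ideal (MvPolynomial (Fin n) 𝕜)) (j : ℕ) : Prop :=
  IsLeast {j' : ℕ | RowNonzero I j'} j

/-- Row `j` of the Betti table has length `l`: its last nonzero entry is in column `l`. -/
def RowHasLength {𝕜 : Type u} [Field 𝕜] {n : ℕ}
    (I : Ideal (MvPolynomial (Fin n) 𝕜)) (j l : ℕ) : Prop :=
  IsGreatest {i : ℕ | gradedBetti I i (i + j) ≠ 0} l

end StarConfiguration

/-! A monomial lies in `starIdeal` exactly when any `c` of its exponents sum to at least `m`. If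
such a monomial is minimal and `k` is its largest exponent, lowering one exponent `k` must break
some `c`-set of sum exactly `m`. An exchange argument then shows that every exponent outside this
set is `k`. So at least `n - c + 1` exponents equal `k`, the degree is `m + (n - c) * k`, and `1 ≤ k
≤ m`. These are the exponents in `gens` (`exists_gen_le`, `starIdeal_eq`).

Order them by `k`, then by the sum of squares `∑ a_i ^ 2`, then by `∑ i * a_i`. With this order the
ideal has linear quotients: the colon ideal of the earlier generators by `x^a` is generated by the
variables `x_l` with `a_l ≤ k - 2`, or with `a_l = k - 1` and an entry `k` at some later position.
One inclusion moves units between exponents (`exists_genKey_lt`), the other is a convexity argument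
(`exists_lt_of_genKey_le`). Degrees do not decrease along the order, so adjoining the generators one
by one gives long exact Tor sequences with vanishing connecting maps, and each generator contributes
a shifted Koszul Betti table (`hasBetti_monomialIdeal`). Hence `β_{i,j}` is the sum of `(colonVars
a).card.choose i` over the generators `a` with `j = i + deg a` (`gradedBetti_starIdeal`).

The rest is counting. For `c < n` the strands are separated by `k`. If `2k ≥ m + 2`, all exponents
other than `k` are at most `k - 2`, so every colon set has `c - 1` elements; `k = m` gives the
bottom row. For `k = 1` the generators are squarefree, and the top row comes from a bijection
(`sum_choose_card_gaps`). If a strand with smaller `k` is present, there is enough room for a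
generator with the full number `c - 1` of colon variables (`exists_card_colonVars_eq`).

Tor is handled through the degree `j` pieces of the tensor product with the given resolution, which
form complexes of vector spaces; `HasBetti` records the ranks of their homology, and
`gradedBetti_eq` returns to `gradedBetti`. -/

namespace StarConfiguration

/-! ### Ranks of homology in short exact sequences of complexes. -/

section HomologyRank

open CategoryTheory

variable {𝕜 : Type u} [Field 𝕜]

theorem rank_eq_zero_iff_isZero (X : ModuleCat.{u} 𝕜) : Module.rank 𝕜 X = 0 ↔ Limits.IsZero X := by
  rw [rank_zero_iff, ModuleCat.isZero_iff_subsingleton]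

/-- Homology can be computed from any surjection on the cycles whose kernel is the boundaries. The
target index `k` is a parameter so that spot `0`, where the outgoing differential is the zero map to
itself, is covered too. -/
theorem rank_homology_eq_of_surjective (K : ChainComplex (ModuleCat.{u} 𝕜) ℕ) (i k : ℕ)
    (hk : (ComplexShape.down ℕ).next i = k) {V : Type u} [AddCommGroup V] [Module 𝕜 V]
    (φ : LinearMap.ker (K.d i k).hom →ₗ[𝕜] V) (hφ : Function.Surjective φ)
    (h : ∀ z, φ z = 0 ↔ ∃ y, (K.d (i + 1) i).hom y = z.1) :
    Module.rank 𝕜 (K.homology i) = Module.rank 𝕜 V := by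
  have e1 := (K.homologyIsoSc' (i + 1) i k (by simp) hk ≪≫
    (K.sc' (i + 1) i k).moduleCatHomologyIso).toLinearEquiv
  rw [e1.rank_eq]
  let ψ : LinearMap.ker (K.sc' (i + 1) i k).g.hom →ₗ[𝕜] V := φ
  have hψ : Function.Surjective ψ := hφ
  have hker : LinearMap.range (K.sc' (i + 1) i k).moduleCatToCycles = LinearMap.ker ψ := by
    ext z
    refine Iff.trans ?_ (h z).symm
    constructor
    · rintro ⟨y, rfl⟩
      exact ⟨y, rfl⟩
    · rintro ⟨y, hy⟩
      exact ⟨y, Subtype.ext hy⟩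
  exact ((Submodule.quotEquivOfEq _ _ hker).trans (ψ.quotKerEquivOfSurjective hψ)).rank_eq

variable {S : ShortComplex (ChainComplex (ModuleCat.{u} 𝕜) ℕ)}

theorem homologyMap_eq_zero
    (h : ∀ i, Module.rank 𝕜 (S.X₁.homology i) = 0 ∨ Module.rank 𝕜 (S.X₂.homology i) = 0)
    (i : ℕ) : HomologicalComplex.homologyMap S.f i = 0 := by
  rcases h i with h | h
  · exact ((rank_eq_zero_iff_isZero _).1 h).eq_of_src _ _
  · exact ((rank_eq_zero_iff_isZero _).1 h).eq_of_tgt _ _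

variable (hS : S.ShortExact)
include hS

/-- The hypothesis makes every connecting map zero for lack of a nonzero source or target, so the
long exact sequence breaks into short ones. -/
theorem rank_homology_middle
    (h : ∀ i, Module.rank 𝕜 (S.X₃.homology (i + 1)) = 0 ∨ Module.rank 𝕜 (S.X₁.homology i) = 0)
    (i : ℕ) : Module.rank 𝕜 (S.X₂.homology i) =
      Module.rank 𝕜 (S.X₁.homology i) + Module.rank 𝕜 (S.X₃.homology i) := by
  have hδ : ∀ i, hS.δ (i + 1) i (by simp) = 0 := fun i => by
    rcases h i with h | h
    · exact ((rank_eq_zero_iff_isZero _).1 h).eq_of_src _ _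
    · exact ((rank_eq_zero_iff_isZero _).1 h).eq_of_tgt _ _
  have hm : Mono (HomologicalComplex.homologyMap S.f i) :=
    (hS.homology_exact₁ (i + 1) i (by simp)).mono_g (hδ i)
  have he : Epi (HomologicalComplex.homologyMap S.g i) := by
    have := hS.epi_g
    rcases i with - | i
    · exact HomologicalComplex.epi_homologyMap_of_epi_of_not_rel _ _ (by simp)
    · exact (hS.homology_exact₃ (i + 1) i (by simp)).epi_f (hδ i)
  exact ModuleCat.free_shortExact_rank_add
    { exact := hS.homology_exact₂ i, mono_f := hm, epi_g := he }

/-- Here the maps induced by the inclusion vanish instead, so the connecting map is onto. -/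
theorem rank_homology_right_succ
    (h : ∀ i, Module.rank 𝕜 (S.X₁.homology i) = 0 ∨ Module.rank 𝕜 (S.X₂.homology i) = 0)
    (i : ℕ) : Module.rank 𝕜 (S.X₃.homology (i + 1)) =
      Module.rank 𝕜 (S.X₂.homology (i + 1)) + Module.rank 𝕜 (S.X₁.homology i) := by
  have hf := homologyMap_eq_zero h
  have hm : Mono (HomologicalComplex.homologyMap S.g (i + 1)) :=
    (hS.homology_exact₂ (i + 1)).mono_g (hf _)
  have he : Epi (hS.δ (i + 1) i (by simp)) :=
    (hS.homology_exact₁ (i + 1) i (by simp)).epi_f (hf _)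
  exact ModuleCat.free_shortExact_rank_add
    { exact := hS.homology_exact₃ (i + 1) i (by simp), mono_f := hm, epi_g := he }

theorem rank_homology_right_zero
    (h : ∀ i, Module.rank 𝕜 (S.X₁.homology i) = 0 ∨ Module.rank 𝕜 (S.X₂.homology i) = 0) :
    Module.rank 𝕜 (S.X₃.homology 0) = Module.rank 𝕜 (S.X₂.homology 0) := by
  have hf := homologyMap_eq_zero h
  have hm : Mono (HomologicalComplex.homologyMap S.g 0) := (hS.homology_exact₂ 0).mono_g (hf _)
  have he : Epi (HomologicalComplex.homologyMap S.g 0) := by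
    have := hS.epi_g
    exact HomologicalComplex.epi_homologyMap_of_epi_of_not_rel _ _ (by simp)
  have := isIso_of_mono_of_epi (HomologicalComplex.homologyMap S.g 0)
  exact (asIso (HomologicalComplex.homologyMap S.g 0)).toLinearEquiv.rank_eq.symm

end HomologyRank

end StarConfiguration

/-! ### Graded modules and the degree pieces of the complex computing Tor. -/

namespace StarConfiguration

/-- The homogeneous polynomials of degree `z`, for an integer `z`. -/
noncomputable def polyDegree (𝕜 : Type u) [Field 𝕜] (n : ℕ) (z : ℤ) :
    Submodule 𝕜 (MvPolynomial (Fin n) 𝕜) where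
  carrier := {f | ∀ e : Fin n →₀ ℕ, f.coeff e ≠ 0 → (e.degree : ℤ) = z}
  zero_mem' := fun e h => by simp at h
  add_mem' := fun {f g} hf hg e h => by
    by_cases hfe : f.coeff e = 0
    · exact hg e fun hge => h (by simp [hfe, hge])
    · exact hf e hfe
  smul_mem' := fun a f hf e h => hf e fun hfe => h (by simp [hfe])

/-- A `ℤ`-indexed family of subspaces of an `S`-module which is compatible with the standard
grading of `S = 𝕜[x_1, …, x_n]`. -/
structure Grading (𝕜 : Type u) [Field 𝕜] (n : ℕ) (M : Type u) [AddCommGroup M]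
    [Module (MvPolynomial (Fin n) 𝕜) M] [Module 𝕜 M] where
  piece : ℤ → Submodule 𝕜 M
  smul_mem : ∀ {a p : ℤ} {s : MvPolynomial (Fin n) 𝕜} {x : M},
    s ∈ polyDegree 𝕜 n a → x ∈ piece p → s • x ∈ piece (p + a)

section

variable {𝕜 : Type u} [Field 𝕜] {n : ℕ}

theorem mem_polyDegree {z : ℤ} {f : MvPolynomial (Fin n) 𝕜} :
    f ∈ polyDegree 𝕜 n z ↔ ∀ e : Fin n →₀ ℕ, f.coeff e ≠ 0 → (e.degree : ℤ) = z := Iff.rfl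

theorem mul_mem_polyDegree {a b : ℤ} {f g : MvPolynomial (Fin n) 𝕜}
    (hf : f ∈ polyDegree 𝕜 n a) (hg : g ∈ polyDegree 𝕜 n b) : f * g ∈ polyDegree 𝕜 n (a + b) := by
  classical
  intro e he
  rw [MvPolynomial.coeff_mul] at he
  obtain ⟨⟨p, q⟩, hpq, hne⟩ := Finset.exists_ne_zero_of_sum_ne_zero he
  rw [Finset.HasAntidiagonal.mem_antidiagonal] at hpq
  have h1 := hf p (left_ne_zero_of_mul hne)
  have h2 := hg q (right_ne_zero_of_mul hne)
  rw [← hpq, map_add]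
  push_cast
  rw [h1, h2]

theorem monomial_mem_polyDegree (e : Fin n →₀ ℕ) (a : 𝕜) :
    MvPolynomial.monomial e a ∈ polyDegree 𝕜 n e.degree := by
  classical
  intro e' he'
  rw [MvPolynomial.coeff_monomial] at he'
  split_ifs at he' with h
  · rw [h]
  · exact absurd rfl he'

theorem mem_freeDegree {B : Type u} {deg : B → ℕ} {q : ℕ} {f : B →₀ MvPolynomial (Fin n) 𝕜} :
    f ∈ freeDegree deg q ↔ ∀ b, f b ∈ polyDegree 𝕜 n ((q : ℤ) - deg b) := by
  constructor
  · intro h b e he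
    have := h b e he
    omega
  · intro h b e he
    have := h b e he
    omega

theorem single_one_mem_freeDegree {B : Type u} (deg : B → ℕ) (b : B) :
    (Finsupp.single b 1 : B →₀ MvPolynomial (Fin n) 𝕜) ∈ freeDegree deg (deg b) := by
  classical
  rw [mem_freeDegree]
  intro b'
  rw [Finsupp.single_apply]
  split_ifs with h
  · subst h
    simpa using monomial_mem_polyDegree (n := n) 0 (1 : 𝕜)
  · exact zero_mem _

variable {M : Type u} [AddCommGroup M] [Module (MvPolynomial (Fin n) 𝕜) M] [Module 𝕜 M]
  [IsScalarTower 𝕜 (MvPolynomial (Fin n) 𝕜) M]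

open scoped Classical in
/-- The coordinates of an element of `M ⊗ F_i` with respect to the basis of `F_i`. -/
noncomputable def tensorCoord (𝕜 : Type u) [Field 𝕜] (n : ℕ) (M : Type u) [AddCommGroup M]
    [Module (MvPolynomial (Fin n) 𝕜) M] (i : ℕ) :
    (M ⊗[MvPolynomial (Fin n) 𝕜] resObj 𝕜 n i) ≃ₗ[MvPolynomial (Fin n) 𝕜]
      ((resolution 𝕜 n i).B →₀ M) :=
  TensorProduct.finsuppScalarRight _ _ M _

omit [Module 𝕜 M] [IsScalarTower 𝕜 (MvPolynomial (Fin n) 𝕜) M] in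
theorem tensorCoord_tmul (i : ℕ) (x : M) (f : resObj 𝕜 n i) (b : (resolution 𝕜 n i).B) :
    tensorCoord 𝕜 n M i (x ⊗ₜ f) b = f b • x := by
  classical exact TensorProduct.finsuppScalarRight_apply_tmul_apply x f b

omit [Module 𝕜 M] [IsScalarTower 𝕜 (MvPolynomial (Fin n) 𝕜) M] in
theorem eq_sum_tensorCoord (i : ℕ) (t : M ⊗[MvPolynomial (Fin n) 𝕜] resObj 𝕜 n i) :
    t = (tensorCoord 𝕜 n M i t).sum fun b x => x ⊗ₜ (Finsupp.single b 1 : resObj 𝕜 n i) := by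
  classical
  apply (tensorCoord 𝕜 n M i).injective
  rw [Finsupp.sum, map_sum]
  conv_lhs => rw [← Finsupp.sum_single (tensorCoord 𝕜 n M i t), Finsupp.sum]
  refine Finset.sum_congr rfl fun b _ => ?_
  rw [← LinearEquiv.symm_apply_eq]
  exact TensorProduct.finsuppScalarRight_symm_apply_single b _

/-- The degree `j` part of `M ⊗ F_i`. -/
noncomputable def tensorPiece (ℳ : Grading 𝕜 n M) (i : ℕ) (j : ℤ) :
    Submodule 𝕜 (M ⊗[MvPolynomial (Fin n) 𝕜] resObj 𝕜 n i) where
  carrier := {t | ∀ b, tensorCoord 𝕜 n M i t b ∈ ℳ.piece (j - (resolution 𝕜 n i).deg b)}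
  zero_mem' := fun b => by simp
  add_mem' := fun {s t} hs ht b => by
    rw [map_add, Finsupp.add_apply]
    exact add_mem (hs b) (ht b)
  smul_mem' := fun a t ht b => by
    rw [← algebraMap_smul (MvPolynomial (Fin n) 𝕜) a t, map_smul, Finsupp.smul_apply,
      algebraMap_smul]
    exact Submodule.smul_mem _ _ (ht b)

theorem tmul_mem_tensorPiece (ℳ : Grading 𝕜 n M) {i q : ℕ} {p j : ℤ} (hpq : p + q = j) {x : M}
    (hx : x ∈ ℳ.piece p) {f : resObj 𝕜 n i} (hf : f ∈ freeDegree (resolution 𝕜 n i).deg q) :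
    x ⊗ₜ f ∈ tensorPiece ℳ i j := by
  intro b
  rw [tensorCoord_tmul]
  have := ℳ.smul_mem (mem_freeDegree.1 hf b) hx
  rwa [show p + ((q : ℤ) - (resolution 𝕜 n i).deg b) = j - (resolution 𝕜 n i).deg b by omega]
    at this

theorem resMap_single (i : ℕ) (b : (resolution 𝕜 n (i + 1)).B) :
    resMap 𝕜 n i (Finsupp.single b 1) = b.1.2 := by
  refine (Finsupp.linearCombination_single _ _ _).trans ?_
  rw [one_smul]

theorem lTensor_resMap_mem (ℳ : Grading 𝕜 n M) {i : ℕ} {j : ℤ}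
    {t : M ⊗[MvPolynomial (Fin n) 𝕜] resObj 𝕜 n (i + 1)} (ht : t ∈ tensorPiece ℳ (i + 1) j) :
    (resMap 𝕜 n i).lTensor M t ∈ tensorPiece ℳ i j := by
  rw [eq_sum_tensorCoord _ t, Finsupp.sum, map_sum]
  refine sum_mem fun b _ => ?_
  rw [LinearMap.lTensor_tmul, resMap_single]
  exact tmul_mem_tensorPiece ℳ (by simp [resolution]) (ht b) b.2.2

/-- The differential of the degree `j` part of `M ⊗ F`. -/
noncomputable def pieceMap (ℳ : Grading 𝕜 n M) (i : ℕ) (j : ℤ) :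
    tensorPiece ℳ (i + 1) j →ₗ[𝕜] tensorPiece ℳ i j :=
  (((resMap 𝕜 n i).lTensor M).restrictScalars 𝕜).restrict fun _ ht => lTensor_resMap_mem ℳ ht

theorem resMap_comp_resMap (i : ℕ) : (resMap 𝕜 n i).comp (resMap 𝕜 n (i + 1)) = 0 := by
  refine Finsupp.lhom_ext' fun b => LinearMap.ext_ring ?_
  simp only [LinearMap.comp_apply, Finsupp.lsingle_apply, LinearMap.zero_apply]
  exact (congrArg _ (resMap_single (i + 1) b)).trans b.2.1

omit [Module 𝕜 M] [IsScalarTower 𝕜 (MvPolynomial (Fin n) 𝕜) M] in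
theorem lTensor_resMap_resMap (i : ℕ) (t : M ⊗[MvPolynomial (Fin n) 𝕜] resObj 𝕜 n (i + 1 + 1)) :
    (resMap 𝕜 n i).lTensor M ((resMap 𝕜 n (i + 1)).lTensor M t) = 0 := by
  rw [← LinearMap.comp_apply, ← LinearMap.lTensor_comp, resMap_comp_resMap, LinearMap.lTensor_zero,
    LinearMap.zero_apply]

theorem pieceMap_comp_pieceMap (ℳ : Grading 𝕜 n M) (i : ℕ) (j : ℤ) :
    (pieceMap ℳ i j).comp (pieceMap ℳ (i + 1) j) = 0 :=
  LinearMap.ext fun t => Subtype.ext (lTensor_resMap_resMap i t.1)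

open CategoryTheory in
/-- The degree `j` part of the complex `M ⊗ F`. -/
noncomputable def torComplex (ℳ : Grading 𝕜 n M) (j : ℤ) : ChainComplex (ModuleCat.{u} 𝕜) ℕ :=
  ChainComplex.of (fun i => ModuleCat.of 𝕜 (tensorPiece ℳ i j))
    (fun i => ModuleCat.ofHom (pieceMap ℳ i j)) fun i => by
      rw [← ModuleCat.ofHom_comp, pieceMap_comp_pieceMap]
      rfl

theorem torComplex_d (ℳ : Grading 𝕜 n M) (i : ℕ) (j : ℤ) :
    (torComplex ℳ j).d (i + 1) i = ModuleCat.ofHom (pieceMap ℳ i j) :=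
  ChainComplex.of_d (fun i => ModuleCat.of 𝕜 (tensorPiece ℳ i j))
    (fun i => ModuleCat.ofHom (pieceMap ℳ i j)) i

/-- `β i j` is the dimension of the degree `j` part of `Tor_i(M, 𝕜)`. -/
def HasBetti (ℳ : Grading 𝕜 n M) (β : ℕ → ℤ → ℕ) : Prop :=
  ∀ i j, Module.rank 𝕜 ((torComplex ℳ j).homology i) = β i j

end

/-! ### Betti numbers along graded short exact sequences. -/

section Exact

open CategoryTheory

variable {𝕜 : Type u} [Field 𝕜] {n : ℕ}
variable {A : Type u} [AddCommGroup A] [Module (MvPolynomial (Fin n) 𝕜) A] [Module 𝕜 A]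
  [IsScalarTower 𝕜 (MvPolynomial (Fin n) 𝕜) A]
variable {B : Type u} [AddCommGroup B] [Module (MvPolynomial (Fin n) 𝕜) B] [Module 𝕜 B]
  [IsScalarTower 𝕜 (MvPolynomial (Fin n) 𝕜) B]
variable {C : Type u} [AddCommGroup C] [Module (MvPolynomial (Fin n) 𝕜) C] [Module 𝕜 C]
  [IsScalarTower 𝕜 (MvPolynomial (Fin n) 𝕜) C]

omit [Module 𝕜 A] [IsScalarTower 𝕜 (MvPolynomial (Fin n) 𝕜) A]
  [Module 𝕜 B] [IsScalarTower 𝕜 (MvPolynomial (Fin n) 𝕜) B] in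
theorem tensorCoord_rTensor (f : A →ₗ[MvPolynomial (Fin n) 𝕜] B) (i : ℕ)
    (t : A ⊗[MvPolynomial (Fin n) 𝕜] resObj 𝕜 n i) (b : (resolution 𝕜 n i).B) :
    tensorCoord 𝕜 n B i (f.rTensor _ t) b = f (tensorCoord 𝕜 n A i t b) := by
  induction t with
  | zero => simp
  | tmul x g => rw [LinearMap.rTensor_tmul, tensorCoord_tmul, tensorCoord_tmul, map_smul]
  | add s t hs ht => rw [map_add, map_add, Finsupp.add_apply, hs, ht, map_add, Finsupp.add_apply,
      map_add]

/-- The map on degree `j` parts induced by a homogeneous map. -/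
noncomputable def pieceFunctor (𝒜 : Grading 𝕜 n A) (ℬ : Grading 𝕜 n B)
    (f : A →ₗ[MvPolynomial (Fin n) 𝕜] B) (hf : ∀ p, ∀ a ∈ 𝒜.piece p, f a ∈ ℬ.piece p)
    (i : ℕ) (j : ℤ) : tensorPiece 𝒜 i j →ₗ[𝕜] tensorPiece ℬ i j :=
  ((f.rTensor (resObj 𝕜 n i)).restrictScalars 𝕜).restrict fun t ht b => by
    have := hf _ _ (ht b)
    rwa [← tensorCoord_rTensor] at this

/-- The chain map induced by a homogeneous map. -/
noncomputable def torComplexMap (𝒜 : Grading 𝕜 n A) (ℬ : Grading 𝕜 n B)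
    (f : A →ₗ[MvPolynomial (Fin n) 𝕜] B) (hf : ∀ p, ∀ a ∈ 𝒜.piece p, f a ∈ ℬ.piece p)
    (j : ℤ) : torComplex 𝒜 j ⟶ torComplex ℬ j :=
  ChainComplex.ofHom (fun i => ModuleCat.ofHom (pieceFunctor 𝒜 ℬ f hf i j)) fun i => by
    rw [torComplex_d, torComplex_d]
    ext t
    refine Subtype.ext ?_
    change (resMap 𝕜 n i).lTensor B (f.rTensor _ t.1) = f.rTensor _ ((resMap 𝕜 n i).lTensor A t.1)
    rw [← LinearMap.comp_apply, ← LinearMap.comp_apply, LinearMap.lTensor_comp_rTensor,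
      LinearMap.rTensor_comp_lTensor]

/-- A short exact sequence `0 → A → B → C → 0` of graded modules. -/
structure GradedExact (𝒜 : Grading 𝕜 n A) (ℬ : Grading 𝕜 n B) (𝒞 : Grading 𝕜 n C)
    (f : A →ₗ[MvPolynomial (Fin n) 𝕜] B) (g : B →ₗ[MvPolynomial (Fin n) 𝕜] C) : Prop where
  left_mem : ∀ p, ∀ a ∈ 𝒜.piece p, f a ∈ ℬ.piece p
  right_mem : ∀ p, ∀ b ∈ ℬ.piece p, g b ∈ 𝒞.piece p
  injective : Function.Injective f
  comp_eq_zero : ∀ a, g (f a) = 0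
  exact : ∀ p, ∀ b ∈ ℬ.piece p, g b = 0 → ∃ a ∈ 𝒜.piece p, f a = b
  surjective : ∀ p, ∀ c ∈ 𝒞.piece p, ∃ b ∈ ℬ.piece p, g b = c

variable {𝒜 : Grading 𝕜 n A} {ℬ : Grading 𝕜 n B} {𝒞 : Grading 𝕜 n C}
  {f : A →ₗ[MvPolynomial (Fin n) 𝕜] B} {g : B →ₗ[MvPolynomial (Fin n) 𝕜] C}

/-- Since `F_i` is free, homogeneous lifts can be chosen coordinate by coordinate. The form of `hg`
serves both surjectivity on the right and exactness in the middle. -/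
theorem exists_rTensor_eq (hg : ∀ p, ∀ c ∈ 𝒞.piece p, (∃ b, g b = c) → ∃ b ∈ ℬ.piece p, g b = c)
    {i : ℕ} {j : ℤ} {t : C ⊗[MvPolynomial (Fin n) 𝕜] resObj 𝕜 n i} (ht : t ∈ tensorPiece 𝒞 i j)
    (hr : ∀ b, ∃ x, g x = tensorCoord 𝕜 n C i t b) :
    ∃ s ∈ tensorPiece ℬ i j, g.rTensor _ s = t := by
  choose y hy hgy using fun b => hg _ _ (ht b) (hr b)
  refine ⟨∑ b ∈ (tensorCoord 𝕜 n C i t).support, y b ⊗ₜ Finsupp.single b 1,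
    sum_mem fun b _ => tmul_mem_tensorPiece ℬ (by simp) (hy b) (single_one_mem_freeDegree _ b), ?_⟩
  conv_rhs => rw [eq_sum_tensorCoord i t, Finsupp.sum]
  rw [map_sum]
  exact Finset.sum_congr rfl fun b _ => by rw [LinearMap.rTensor_tmul, hgy]

namespace GradedExact

/-- The short complex of complexes of degree `j` parts. -/
noncomputable def shortComplex (h : GradedExact 𝒜 ℬ 𝒞 f g) (j : ℤ) :
    ShortComplex (ChainComplex (ModuleCat.{u} 𝕜) ℕ) :=
  ShortComplex.mk (torComplexMap 𝒜 ℬ f h.left_mem j) (torComplexMap ℬ 𝒞 g h.right_mem j) (by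
    ext i t
    refine Subtype.ext ?_
    change g.rTensor _ (f.rTensor _ t.1) = 0
    rw [← LinearMap.comp_apply, ← LinearMap.rTensor_comp,
      show g.comp f = 0 from LinearMap.ext h.comp_eq_zero, LinearMap.rTensor_zero,
      LinearMap.zero_apply])

theorem shortExact (h : GradedExact 𝒜 ℬ 𝒞 f g) (j : ℤ) : (h.shortComplex j).ShortExact := by
  refine HomologicalComplex.shortExact_of_degreewise_shortExact _ fun i => ?_
  refine ModuleCat.shortComplex_shortExact _ ?_ ?_ ?_
  · intro t
    constructor
    · intro ht
      have ht' : g.rTensor _ t.1 = 0 := congrArg Subtype.val ht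
      obtain ⟨s, hs, hst⟩ := exists_rTensor_eq (𝒞 := ℬ) (ℬ := 𝒜) (g := f) (t := t.1) (j := j)
        (fun p c hc ⟨b, hb⟩ => h.exact p c hc (hb ▸ h.comp_eq_zero b)) t.2 (fun b => by
          obtain ⟨a, -, ha⟩ := h.exact _ _ (t.2 b) (by
            rw [← tensorCoord_rTensor, ht', map_zero, Finsupp.zero_apply])
          exact ⟨a, ha⟩)
      exact ⟨⟨s, hs⟩, Subtype.ext hst⟩
    · rintro ⟨s, rfl⟩
      exact congrArg (fun φ => (φ.f i).hom s) (h.shortComplex j).zero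
  · intro s t hst
    have hst' : f.rTensor _ s.1 = f.rTensor _ t.1 := congrArg Subtype.val hst
    refine Subtype.ext ((tensorCoord 𝕜 n A i).injective (Finsupp.ext fun b => h.injective ?_))
    rw [← tensorCoord_rTensor, ← tensorCoord_rTensor, hst']
  · intro t
    obtain ⟨s, hs, hst⟩ := exists_rTensor_eq (𝒞 := 𝒞) (ℬ := ℬ) (g := g) (t := t.1) (j := j)
        (fun p c hc _ => h.surjective p c hc) t.2 (fun b => by
          obtain ⟨a, -, ha⟩ := h.surjective _ _ (t.2 b)
          exact ⟨a, ha⟩)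
    exact ⟨⟨s, hs⟩, Subtype.ext hst⟩

theorem hasBetti_middle (h : GradedExact 𝒜 ℬ 𝒞 f g) {α γ : ℕ → ℤ → ℕ} (hα : HasBetti 𝒜 α)
    (hγ : HasBetti 𝒞 γ) (h0 : ∀ i j, γ (i + 1) j = 0 ∨ α i j = 0) :
    HasBetti ℬ fun i j => α i j + γ i j := by
  intro i j
  refine (rank_homology_middle (h.shortExact j) (fun i => ?_) i).trans ?_
  · rcases h0 i j with h0 | h0
    · exact Or.inl ((hγ (i + 1) j).trans (by simp [h0]))
    · exact Or.inr ((hα i j).trans (by simp [h0]))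
  · push_cast
    exact congrArg₂ _ (hα i j) (hγ i j)

/-- The mapping cone situation without cancellation: the tables of the first two modules never meet
in the same position. -/
theorem hasBetti_right (h : GradedExact 𝒜 ℬ 𝒞 f g) {α β γ : ℕ → ℤ → ℕ} (hα : HasBetti 𝒜 α)
    (hβ : HasBetti ℬ β) (h0 : ∀ i j, α i j = 0 ∨ β i j = 0) (hγ0 : ∀ j, γ 0 j = β 0 j)
    (hγ : ∀ i j, γ (i + 1) j = β (i + 1) j + α i j) : HasBetti 𝒞 γ := by
  intro i j
  have h0' : ∀ i, Module.rank 𝕜 ((h.shortComplex j).X₁.homology i) = 0 ∨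
      Module.rank 𝕜 ((h.shortComplex j).X₂.homology i) = 0 := fun i => by
    rcases h0 i j with h0 | h0
    · exact Or.inl ((hα i j).trans (by simp [h0]))
    · exact Or.inr ((hβ i j).trans (by simp [h0]))
  rcases i with - | i
  · rw [hγ0, ← hβ 0 j]
    exact rank_homology_right_zero (h.shortExact j) h0'
  · rw [hγ]
    push_cast
    rw [← hβ, ← hα]
    exact rank_homology_right_succ (h.shortExact j) h0' i

end GradedExact

end Exact

end StarConfiguration

namespace StarConfiguration

variable {𝕜 : Type u} [Field 𝕜] {n : ℕ}

/-! ### Tor of a shifted free module of rank one. -/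

section Free

/-- The grading of `S(-d)`. -/
noncomputable def polyGrading (𝕜 : Type u) [Field 𝕜] (n : ℕ) (d : ℤ) :
    Grading 𝕜 n (MvPolynomial (Fin n) 𝕜) where
  piece p := polyDegree 𝕜 n (p - d)
  smul_mem {a p s x} hs hx := by
    have := mul_mem_polyDegree hs hx
    rwa [show a + (p - d) = p + a - d by ring] at this

theorem eq_zero_of_mem_polyDegree_neg {z : ℤ} (hz : z < 0) {f : MvPolynomial (Fin n) 𝕜}
    (hf : f ∈ polyDegree 𝕜 n z) : f = 0 := by
  ext e
  by_contra h
  have := hf e h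
  omega

theorem tensorCoord_poly_tmul (i : ℕ) (x : MvPolynomial (Fin n) 𝕜) (f : resObj 𝕜 n i) :
    tensorCoord 𝕜 n (MvPolynomial (Fin n) 𝕜) i (x ⊗ₜ f) = x • f :=
  Finsupp.ext fun b => by
    rw [tensorCoord_tmul, Finsupp.smul_apply, smul_eq_mul, smul_eq_mul, mul_comm]

theorem tensorCoord_lTensor (i : ℕ)
    (t : MvPolynomial (Fin n) 𝕜 ⊗[MvPolynomial (Fin n) 𝕜] resObj 𝕜 n (i + 1)) :
    tensorCoord 𝕜 n _ i ((resMap 𝕜 n i).lTensor _ t) = resMap 𝕜 n i (tensorCoord 𝕜 n _ (i + 1) t) := by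
  induction t with
  | zero => simp
  | tmul x f => rw [LinearMap.lTensor_tmul, tensorCoord_poly_tmul, tensorCoord_poly_tmul, map_smul]
  | add s t hs ht => rw [map_add, map_add, hs, ht, map_add, map_add]

theorem resMap_mem (i : ℕ) (f : resObj 𝕜 n (i + 1)) : resMap 𝕜 n i f ∈ (resolution 𝕜 n i).N := by
  have h := Finsupp.linearCombination_apply (MvPolynomial (Fin n) 𝕜)
    (v := fun p : (resolution 𝕜 n i).Gen => p.1.2) f
  refine (congrArg (· ∈ (resolution 𝕜 n i).N) h).mpr ?_
  exact Submodule.sum_mem _ fun b _ => Submodule.smul_mem _ _ b.2.1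

/-- The basis of `F_{i+1}` consists of all homogeneous elements of the syzygy module, so a
homogeneous syzygy is the image of the basis vector that it indexes. -/
theorem exists_lTensor_eq {d j : ℤ} {i : ℕ}
    {t : MvPolynomial (Fin n) 𝕜 ⊗[MvPolynomial (Fin n) 𝕜] resObj 𝕜 n i}
    (ht : t ∈ tensorPiece (polyGrading 𝕜 n d) i j)
    (hN : tensorCoord 𝕜 n _ i t ∈ (resolution 𝕜 n i).N) :
    ∃ s ∈ tensorPiece (polyGrading 𝕜 n d) (i + 1) j, (resMap 𝕜 n i).lTensor _ s = t := by
  rcases lt_or_ge j d with hjd | hjd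
  -- The basis degrees are natural numbers, so for `j < d` all coordinates have negative degree and
  -- `t` vanishes.
  · refine ⟨0, zero_mem _, ?_⟩
    rw [map_zero]
    refine ((tensorCoord 𝕜 n _ i).map_eq_zero_iff.1 (Finsupp.ext fun b => ?_)).symm
    exact eq_zero_of_mem_polyDegree_neg (by omega) (ht b)
  · obtain ⟨q, hq⟩ := Int.eq_ofNat_of_zero_le (sub_nonneg.2 hjd)
    have hz : tensorCoord 𝕜 n _ i t ∈ freeDegree (resolution 𝕜 n i).deg q :=
      mem_freeDegree.2 fun b => by
        have := ht b
        simp only [polyGrading] at this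
        rwa [show j - ((resolution 𝕜 n i).deg b : ℤ) - d = q - (resolution 𝕜 n i).deg b by omega]
          at this
    let b : (resolution 𝕜 n (i + 1)).B := ⟨(q, tensorCoord 𝕜 n _ i t), hN, hz⟩
    refine ⟨1 ⊗ₜ Finsupp.single b 1, tmul_mem_tensorPiece _ (p := d) (q := q) (by omega) ?_
      (single_one_mem_freeDegree _ b), ?_⟩
    · simpa [polyGrading] using monomial_mem_polyDegree (n := n) 0 (1 : 𝕜)
    · rw [LinearMap.lTensor_tmul, resMap_single]
      apply (tensorCoord 𝕜 n _ i).injective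
      rw [tensorCoord_poly_tmul, one_smul]

theorem mem_span_X_of_coeff_zero {f : MvPolynomial (Fin n) 𝕜} : f ∈ Ideal.span
    (Set.range (MvPolynomial.X : Fin n → MvPolynomial (Fin n) 𝕜)) ↔ f.coeff 0 = 0 := by
  rw [← Set.image_univ, MvPolynomial.mem_ideal_span_X_image]
  constructor
  · intro h
    by_contra h0
    obtain ⟨i, -, hi⟩ := h 0 (MvPolynomial.mem_support_iff.2 h0)
    exact hi rfl
  · intro h e he
    by_contra! hne
    have : e = 0 := Finsupp.ext fun i => hne i trivial
    exact MvPolynomial.mem_support_iff.1 he (this ▸ h)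

/-- Tensoring with `S` returns the resolution itself, whose only homology is the residue field,
detected by the constant coefficient. -/
theorem hasBetti_polyGrading (d : ℤ) :
    HasBetti (polyGrading 𝕜 n d) fun i j => if i = 0 ∧ j = d then 1 else 0 := by
  intro i j
  rcases i with - | i
  · by_cases hj : j = d
    · subst hj
      let e : (resolution 𝕜 n 0).B := PUnit.unit
      let φ : tensorPiece (polyGrading 𝕜 n j) 0 j →ₗ[𝕜] 𝕜 :=
        { toFun := fun t => (tensorCoord 𝕜 n (MvPolynomial (Fin n) 𝕜) 0 t.1 e).coeff 0
          map_add' := fun s t => by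
            rw [Submodule.coe_add, map_add, Finsupp.add_apply, MvPolynomial.coeff_add]
          map_smul' := fun a t => by
            rw [Submodule.coe_smul, ← algebraMap_smul (MvPolynomial (Fin n) 𝕜) a t.1, map_smul,
              Finsupp.smul_apply, algebraMap_smul, MvPolynomial.coeff_smul]
            rfl }
      have hd : ∀ t, ((torComplex (polyGrading 𝕜 n j) j).d 0 0).hom t = 0 := fun t => by
        rw [HomologicalComplex.shape _ _ _ (by simp)]
        rfl
      refine (rank_homology_eq_of_surjective _ 0 0 (by simp)
        (φ.comp (Submodule.subtype _)) ?_ ?_).trans ?_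
      · intro a
        have hmem : (MvPolynomial.C a ⊗ₜ Finsupp.single e 1 :
            MvPolynomial (Fin n) 𝕜 ⊗[MvPolynomial (Fin n) 𝕜] resObj 𝕜 n 0) ∈
            tensorPiece (polyGrading 𝕜 n j) 0 j := by
          refine tmul_mem_tensorPiece _ (p := j) (q := 0) (by simp) ?_
            (single_one_mem_freeDegree _ e)
          simpa [polyGrading] using monomial_mem_polyDegree (n := n) 0 a
        refine ⟨⟨⟨_, hmem⟩, hd _⟩, ?_⟩
        change (tensorCoord 𝕜 n (MvPolynomial (Fin n) 𝕜) 0 (_ ⊗ₜ _) e).coeff 0 = a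
        rw [tensorCoord_tmul, Finsupp.single_eq_same, one_smul, MvPolynomial.coeff_zero_C]
      · intro z
        rw [torComplex_d]
        constructor
        · intro hz
          obtain ⟨s, hs, hst⟩ := exists_lTensor_eq (i := 0) z.1.2 (mem_span_X_of_coeff_zero.2 hz)
          exact ⟨⟨s, hs⟩, Subtype.ext hst⟩
        · rintro ⟨y, hy⟩
          have hy' : (resMap 𝕜 n 0).lTensor _ y.1 = z.1.1 := congrArg Subtype.val hy
          have := resMap_mem 0 (tensorCoord 𝕜 n _ 1 y.1)
          rw [← tensorCoord_lTensor 0, hy'] at this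
          exact mem_span_X_of_coeff_zero.1 this
      · simp
    · refine (rank_homology_eq_of_surjective (V := PUnit.{u+1}) _ 0 0 (by simp) 0
        (fun x => ⟨0, Subsingleton.elim _ _⟩) ?_).trans ?_
      · intro z
        rw [torComplex_d]
        refine iff_of_true rfl ?_
        have hz : tensorCoord 𝕜 n _ 0 z.1.1 ∈ (resolution 𝕜 n 0).N := by
          refine mem_span_X_of_coeff_zero.2 ?_
          by_contra h0
          have := z.1.2 PUnit.unit 0 h0
          simp [resolution] at this
          omega
        obtain ⟨s, hs, hst⟩ := exists_lTensor_eq (i := 0) z.1.2 hz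
        exact ⟨⟨s, hs⟩, Subtype.ext hst⟩
      · simp [hj]
  · refine (rank_homology_eq_of_surjective (V := PUnit.{u+1}) _ (i + 1) i (by simp) 0
      (fun x => ⟨0, Subsingleton.elim _ _⟩) ?_).trans ?_
    · intro z
      refine iff_of_true rfl ?_
      rw [torComplex_d]
      have hz := z.2
      simp only [torComplex_d, LinearMap.mem_ker] at hz
      have hz' : (resMap 𝕜 n i).lTensor _ z.1.1 = 0 := congrArg Subtype.val hz
      have hN : tensorCoord 𝕜 n _ (i + 1) z.1.1 ∈ (resolution 𝕜 n (i + 1)).N := by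
        change resMap 𝕜 n i _ = 0
        rw [← tensorCoord_lTensor, hz', map_zero]
      obtain ⟨s, hs, hst⟩ := exists_lTensor_eq z.1.2 hN
      exact ⟨⟨s, hs⟩, Subtype.ext hst⟩
    · simp

end Free

end StarConfiguration

namespace StarConfiguration

variable {𝕜 : Type u} [Field 𝕜] {n : ℕ}

/-! ### Comparison of the degree pieces with `gradedBetti`. -/

section Ideals

/-- The grading of an ideal by the degrees of polynomials. -/
noncomputable def idealGrading (I : Ideal (MvPolynomial (Fin n) 𝕜)) : Grading 𝕜 n I where
  piece p := (polyDegree 𝕜 n p).comap (I.subtype.restrictScalars 𝕜)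
  smul_mem {a p s x} hs hx := by
    have := mul_mem_polyDegree hs (show x.1 ∈ _ from hx)
    rwa [add_comm] at this

theorem mem_idealGrading {I : Ideal (MvPolynomial (Fin n) 𝕜)} {p : ℤ} {x : I} :
    x ∈ (idealGrading I).piece p ↔ x.1 ∈ polyDegree 𝕜 n p := Iff.rfl

theorem polyDegree_natCast (p : ℕ) :
    polyDegree 𝕜 n (p : ℤ) = MvPolynomial.homogeneousSubmodule (Fin n) 𝕜 p := by
  ext f
  rw [MvPolynomial.mem_homogeneousSubmodule, mem_polyDegree]
  refine forall_congr' fun e => imp_congr_right fun _ => ?_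
  rw [Finsupp.degree_eq_weight_one, Nat.cast_inj]
  rfl

theorem idealGrading_natCast (I : Ideal (MvPolynomial (Fin n) 𝕜)) (p : ℕ) :
    (idealGrading I).piece p = idealDegree I p := by
  simp only [idealGrading, polyDegree_natCast, idealDegree]

theorem idealGrading_neg (I : Ideal (MvPolynomial (Fin n) 𝕜)) {z : ℤ} (hz : z < 0) {x : I}
    (hx : x ∈ (idealGrading I).piece z) : x = 0 :=
  Subtype.ext (eq_zero_of_mem_polyDegree_neg hz hx)

theorem tensorDegree_idealDegree (I : Ideal (MvPolynomial (Fin n) 𝕜)) (i j : ℕ) :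
    tensorDegree (n := n) (M := I) (idealDegree I) i j = tensorPiece (idealGrading I) i j := by
  apply le_antisymm
  · refine Submodule.span_le.2 ?_
    rintro _ ⟨p, q, x, f, hpq, hx, hf, rfl⟩
    rw [← idealGrading_natCast] at hx
    exact tmul_mem_tensorPiece _ (by exact_mod_cast hpq) hx hf
  · intro t ht
    rw [eq_sum_tensorCoord _ t, Finsupp.sum]
    refine sum_mem fun b hb => Submodule.subset_span ?_
    have h := ht b
    rcases lt_or_ge (j : ℤ) ((resolution 𝕜 n i).deg b) with hlt | hge
    · exact absurd (idealGrading_neg I (by omega) h) (Finsupp.mem_support_iff.1 hb)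
    · obtain ⟨p, hp⟩ := Int.eq_ofNat_of_zero_le (sub_nonneg.2 hge)
      rw [hp, idealGrading_natCast] at h
      exact ⟨p, _, _, _, by omega, h, single_one_mem_freeDegree _ b, rfl⟩

/-- Homogeneity of `I` allows the coordinates of `y` to be split by degree. The components of degree
other than `j` have no degree `j` part in their image, so they can be dropped when a boundary of
degree `j` is lifted. -/
theorem exists_add_eq_lTensor {I : Ideal (MvPolynomial (Fin n) 𝕜)}
    (hI : ∀ f ∈ I, ∀ p, MvPolynomial.homogeneousComponent p f ∈ I) (i : ℕ) (j : ℤ)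
    (y : I ⊗[MvPolynomial (Fin n) 𝕜] resObj 𝕜 n (i + 1)) :
    ∃ y₁ ∈ tensorPiece (idealGrading I) (i + 1) j, ∃ y₂, y = y₁ + y₂ ∧
      ∀ b (e : Fin n →₀ ℕ), (e.degree : ℤ) = j - (resolution 𝕜 n i).deg b →
        (tensorCoord 𝕜 n I i ((resMap 𝕜 n i).lTensor I y₂) b : MvPolynomial (Fin n) 𝕜).coeff e
          = 0 := by
  rw [eq_sum_tensorCoord _ y, Finsupp.sum]
  refine Finset.sum_induction _ (fun y => ∃ y₁ ∈ tensorPiece (idealGrading I) (i + 1) j, ∃ y₂,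
    y = y₁ + y₂ ∧ ∀ b (e : Fin n →₀ ℕ), (e.degree : ℤ) = j - (resolution 𝕜 n i).deg b →
      (tensorCoord 𝕜 n I i ((resMap 𝕜 n i).lTensor I y₂) b : MvPolynomial (Fin n) 𝕜).coeff e = 0)
    ?_ ?_ ?_
  · rintro _ _ ⟨s₁, hs₁, s₂, rfl, hs₂⟩ ⟨t₁, ht₁, t₂, rfl, ht₂⟩
    refine ⟨s₁ + t₁, add_mem hs₁ ht₁, s₂ + t₂, by abel, fun b e he => ?_⟩
    rw [map_add, map_add, Finsupp.add_apply, Submodule.coe_add, MvPolynomial.coeff_add,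
      hs₂ b e he, ht₂ b e he, add_zero]
  · exact ⟨0, zero_mem _, 0, by simp, by simp⟩
  intro b _
  have hcomp : ∀ (x : I) (p : ℕ), p ≠ j - (resolution 𝕜 n (i + 1)).deg b →
      x ∈ (idealGrading I).piece p → ∀ b' (e : Fin n →₀ ℕ),
      (e.degree : ℤ) = j - (resolution 𝕜 n i).deg b' →
      (tensorCoord 𝕜 n I i ((resMap 𝕜 n i).lTensor I
        (x ⊗ₜ (Finsupp.single b 1 : resObj 𝕜 n (i + 1)))) b' : MvPolynomial (Fin n) 𝕜).coeff e
          = 0 := by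
    intro x p hp hx b' e he
    by_contra hne
    have := lTensor_resMap_mem _ (tmul_mem_tensorPiece (idealGrading I) rfl hx
      (single_one_mem_freeDegree (resolution 𝕜 n (i + 1)).deg b)) b' e hne
    omega
  have hx := MvPolynomial.sum_homogeneousComponent
    (tensorCoord 𝕜 n I (i + 1) y b : MvPolynomial (Fin n) 𝕜)
  generalize tensorCoord 𝕜 n I (i + 1) y b = x at hx
  have hx' : x = ∑ p ∈ Finset.range (x.1.totalDegree + 1),
      (⟨MvPolynomial.homogeneousComponent p x.1, hI _ x.2 p⟩ : I) := by
    refine Subtype.ext ?_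
    rw [AddSubmonoidClass.coe_finsetSum]
    exact hx.symm
  rw [hx', TensorProduct.sum_tmul]
  refine Finset.sum_induction _ (fun y => ∃ y₁ ∈ tensorPiece (idealGrading I) (i + 1) j, ∃ y₂,
    y = y₁ + y₂ ∧ ∀ b (e : Fin n →₀ ℕ), (e.degree : ℤ) = j - (resolution 𝕜 n i).deg b →
      (tensorCoord 𝕜 n I i ((resMap 𝕜 n i).lTensor I y₂) b : MvPolynomial (Fin n) 𝕜).coeff e = 0)
    ?_ ?_ ?_
  · rintro _ _ ⟨s₁, hs₁, s₂, rfl, hs₂⟩ ⟨t₁, ht₁, t₂, rfl, ht₂⟩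
    refine ⟨s₁ + t₁, add_mem hs₁ ht₁, s₂ + t₂, by abel, fun b e he => ?_⟩
    rw [map_add, map_add, Finsupp.add_apply, Submodule.coe_add, MvPolynomial.coeff_add,
      hs₂ b e he, ht₂ b e he, add_zero]
  · exact ⟨0, zero_mem _, 0, by simp, by simp⟩
  intro p _
  have hmem : (⟨MvPolynomial.homogeneousComponent p x.1, hI _ x.2 p⟩ : I) ∈
      (idealGrading I).piece p := by
    rw [mem_idealGrading, polyDegree_natCast]
    exact MvPolynomial.homogeneousComponent_mem p x.1
  by_cases hp : (p : ℤ) = j - (resolution 𝕜 n (i + 1)).deg b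
  · exact ⟨_, tmul_mem_tensorPiece _ (by omega) hmem (single_one_mem_freeDegree _ b), 0,
      by simp, by simp⟩
  · exact ⟨0, zero_mem _, _, by simp, hcomp _ p hp hmem⟩

theorem exists_mem_tensorPiece_of_mem_torBoundaries {I : Ideal (MvPolynomial (Fin n) 𝕜)}
    (hI : ∀ f ∈ I, ∀ p, MvPolynomial.homogeneousComponent p f ∈ I) {i : ℕ} {j : ℤ}
    {z : I ⊗[MvPolynomial (Fin n) 𝕜] resObj 𝕜 n i} (hz : z ∈ tensorPiece (idealGrading I) i j)
    (hb : z ∈ torBoundaries 𝕜 n I i) :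
    ∃ y ∈ tensorPiece (idealGrading I) (i + 1) j, (resMap 𝕜 n i).lTensor I y = z := by
  obtain ⟨y, rfl⟩ := hb
  obtain ⟨y₁, hy₁, y₂, rfl, hy₂⟩ := exists_add_eq_lTensor hI i j y
  refine ⟨y₁, hy₁, ?_⟩
  have h2 : (resMap 𝕜 n i).lTensor I y₂ ∈ tensorPiece (idealGrading I) i j := by
    rw [map_add] at hz
    exact (Submodule.add_mem_iff_right _ (lTensor_resMap_mem _ hy₁)).1 hz
  suffices h : (resMap 𝕜 n i).lTensor I y₂ = 0 by rw [map_add, h, add_zero]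
  refine (tensorCoord 𝕜 n I i).map_eq_zero_iff.1 (Finsupp.ext fun b => Subtype.ext ?_)
  ext e
  by_contra hne
  exact hne (hy₂ b e (h2 b e hne))

/-- Meant for cycles `Z`, boundaries `B` and a degree piece `T`: every class in the degree part of
the homology comes from a homogeneous cycle, so this part is a quotient of `K`. -/
theorem exists_surjective_rank_eq {k S V : Type u} [Field k] [CommRing S] [Algebra k S]
    [AddCommGroup V] [Module S V] [Module k V] [IsScalarTower k S V] (Z B : Submodule S V)
    (T : Submodule k V) (K : Submodule k T) (hK : ∀ z, z ∈ K ↔ z.1 ∈ Z) :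
    ∃ (W : Type u) (_ : AddCommGroup W) (_ : Module k W) (φ : K →ₗ[k] W),
      Function.Surjective φ ∧ (∀ z, φ z = 0 ↔ z.1.1 ∈ B) ∧
      Module.rank k ((T.comap (Z.subtype.restrictScalars k)).map
        ((B.submoduleOf Z).mkQ.restrictScalars k)) = Module.rank k W := by
  let ι : K →ₗ[k] Z :=
    { toFun := fun z => ⟨z.1.1, (hK z.1).1 z.2⟩
      map_add' := fun _ _ => rfl
      map_smul' := fun _ _ => rfl }
  let φ : K →ₗ[k] (T.comap (Z.subtype.restrictScalars k)).map
      ((B.submoduleOf Z).mkQ.restrictScalars k) :=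
    (((B.submoduleOf Z).mkQ.restrictScalars k).comp ι).codRestrict _
      fun z => ⟨ι z, z.1.2, rfl⟩
  refine ⟨_, inferInstance, inferInstance, φ, ?_, fun z => ?_, rfl⟩
  · rintro ⟨_, ⟨z, hz, rfl⟩⟩
    exact ⟨⟨⟨z.1, hz⟩, (hK _).2 z.2⟩, rfl⟩
  · rw [Subtype.ext_iff]
    exact Submodule.Quotient.mk_eq_zero _

theorem exists_next_mem_ker_iff (I : Ideal (MvPolynomial (Fin n) 𝕜)) (i : ℕ) (j : ℤ) :
    ∃ k, (ComplexShape.down ℕ).next i = k ∧ ∀ z : tensorPiece (idealGrading I) i j,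
      z ∈ LinearMap.ker ((torComplex (idealGrading I) j).d i k).hom ↔ z.1 ∈ torCycles 𝕜 n I i := by
  rcases i with - | i
  · refine ⟨0, by simp, fun z => iff_of_true ?_ trivial⟩
    rw [HomologicalComplex.shape _ _ _ (by simp)]
    rfl
  · refine ⟨i, by simp, fun z => ?_⟩
    rw [torComplex_d]
    exact Subtype.ext_iff

theorem gradedBetti_eq {I : Ideal (MvPolynomial (Fin n) 𝕜)}
    (hI : ∀ f ∈ I, ∀ p, MvPolynomial.homogeneousComponent p f ∈ I) {β : ℕ → ℤ → ℕ}
    (hβ : HasBetti (idealGrading I) β) (i j : ℕ) : gradedBetti I i j = β i j := by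
  obtain ⟨k, hk, hcyc⟩ := exists_next_mem_ker_iff I i j
  obtain ⟨W, _, _, φ, hφ, hφ0, hrank⟩ := exists_surjective_rank_eq (k := 𝕜)
    (S := MvPolynomial (Fin n) 𝕜)
    (V := I ⊗[MvPolynomial (Fin n) 𝕜] resObj 𝕜 n i) (torCycles 𝕜 n I i) (torBoundaries 𝕜 n I i)
    (tensorPiece (idealGrading I) i j)
    (LinearMap.ker ((torComplex (idealGrading I) j).d i k).hom) hcyc
  have h1 := rank_homology_eq_of_surjective (torComplex (idealGrading I) j) i k hk
    (V := W) φ hφ fun z => by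
      rw [torComplex_d]
      refine (hφ0 z).trans ⟨fun h => ?_, ?_⟩
      · obtain ⟨y, hy, hyz⟩ := exists_mem_tensorPiece_of_mem_torBoundaries hI z.1.2 h
        exact ⟨⟨y, hy⟩, Subtype.ext hyz⟩
      · rintro ⟨y, hy⟩
        exact ⟨y.1, congrArg Subtype.val hy⟩
  rw [gradedBetti, torDegree, tensorDegree_idealDegree, Module.finrank]
  rw [← h1, hβ i j] at hrank
  exact (congrArg _ hrank).trans (Cardinal.toNat_natCast _)

end Ideals

end StarConfiguration

namespace StarConfiguration

variable {𝕜 : Type u} [Field 𝕜] {n : ℕ}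

/-! ### Koszul Betti numbers and monomial ideals with linear quotients. -/

section LinearQuotients

theorem hasBetti_zero_of_subsingleton {M : Type u} [AddCommGroup M]
    [Module (MvPolynomial (Fin n) 𝕜) M] [Module 𝕜 M] [IsScalarTower 𝕜 (MvPolynomial (Fin n) 𝕜) M]
    [Subsingleton M] (ℳ : Grading 𝕜 n M) : HasBetti ℳ fun _ _ => 0 := by
  intro i j
  have hsub : ∀ z w : tensorPiece ℳ i j, z = w := fun z w =>
    Subtype.ext ((tensorCoord 𝕜 n M i).injective (Finsupp.ext fun b => Subsingleton.elim _ _))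
  refine (rank_homology_eq_of_surjective (V := PUnit.{u+1}) _ i _ rfl 0
    (fun x => ⟨0, Subsingleton.elim _ _⟩) fun z => iff_of_true rfl ⟨0, hsub _ _⟩).trans ?_
  simp

/-- The ideal generated by the variables with index in `P`. -/
noncomputable def varIdeal (𝕜 : Type u) [Field 𝕜] {n : ℕ} (P : Finset (Fin n)) :
    Ideal (MvPolynomial (Fin n) 𝕜) :=
  Ideal.span (MvPolynomial.X '' (P : Set (Fin n)))

theorem mem_varIdeal {P : Finset (Fin n)} {f : MvPolynomial (Fin n) 𝕜} :
    f ∈ varIdeal 𝕜 P ↔ ∀ e : Fin n →₀ ℕ, f.coeff e ≠ 0 → ∃ i ∈ P, e i ≠ 0 := by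
  rw [varIdeal, MvPolynomial.mem_ideal_span_X_image]
  simp only [MvPolynomial.mem_support_iff, Finset.mem_coe]

/-- The grading of `(S/I)(-d)`. -/
noncomputable def quotGrading (I : Ideal (MvPolynomial (Fin n) 𝕜)) (d : ℤ) :
    Grading 𝕜 n (MvPolynomial (Fin n) 𝕜 ⧸ I) where
  piece p := (polyDegree 𝕜 n (p - d)).map (I.mkQ.restrictScalars 𝕜)
  smul_mem := by
    rintro a p s _ hs ⟨x, hx, rfl⟩
    refine ⟨s * x, ?_, rfl⟩
    have := mul_mem_polyDegree hs hx
    rwa [show a + (p - d) = p + a - d by ring] at this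

theorem divMonomial_mem_polyDegree {z : ℤ} {f : MvPolynomial (Fin n) 𝕜}
    (hf : f ∈ polyDegree 𝕜 n z) (a : Fin n →₀ ℕ) :
    f.divMonomial a ∈ polyDegree 𝕜 n (z - a.degree) := by
  intro e he
  rw [MvPolynomial.coeff_divMonomial] at he
  have := hf _ he
  rw [map_add] at this
  push_cast at this
  omega

theorem X_mem_polyDegree (i : Fin n) : (MvPolynomial.X i : MvPolynomial (Fin n) 𝕜) ∈
    polyDegree 𝕜 n 1 := by
  simpa [MvPolynomial.X] using monomial_mem_polyDegree (Finsupp.single i 1) (1 : 𝕜)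

/-- A variable outside `P` is a nonzerodivisor modulo the variables in `P`; every membership is
tested monomial by monomial. -/
theorem gradedExact_varIdeal {P : Finset (Fin n)} {l : Fin n} (hl : l ∉ P) (d : ℤ) :
    GradedExact (quotGrading (varIdeal 𝕜 P) (d + 1)) (quotGrading (varIdeal 𝕜 P) d)
      (quotGrading (varIdeal 𝕜 (insert l P)) d)
      (LinearMap.lsmul _ _ (MvPolynomial.X l : MvPolynomial (Fin n) 𝕜))
      (Submodule.factor (Ideal.span_mono (Set.image_mono (by simp)))) where
  left_mem := by
    rintro p _ ⟨s, hs, rfl⟩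
    refine ⟨MvPolynomial.X l * s, ?_, rfl⟩
    have := mul_mem_polyDegree (X_mem_polyDegree l) hs
    rwa [show 1 + (p - (d + 1)) = p - d by ring] at this
  right_mem := by
    rintro p _ ⟨s, hs, rfl⟩
    exact ⟨s, hs, rfl⟩
  injective := by
    rw [← LinearMap.ker_eq_bot, LinearMap.ker_eq_bot']
    intro y hy
    obtain ⟨s, rfl⟩ := Submodule.mkQ_surjective _ y
    have hs : MvPolynomial.X l * s ∈ varIdeal 𝕜 P := (Submodule.Quotient.mk_eq_zero _).1 hy
    refine (Submodule.Quotient.mk_eq_zero _).2 (mem_varIdeal.2 fun e he => ?_)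
    obtain ⟨i, hi, hei⟩ := mem_varIdeal.1 hs (Finsupp.single l 1 + e)
      (by rwa [MvPolynomial.coeff_X_mul])
    refine ⟨i, hi, ?_⟩
    have hli : l ≠ i := fun h => hl (h ▸ hi)
    simpa [Finsupp.single_apply, hli] using hei
  comp_eq_zero := by
    intro y
    obtain ⟨s, rfl⟩ := Submodule.mkQ_surjective _ y
    refine (Submodule.Quotient.mk_eq_zero _).2 ?_
    exact Ideal.mul_mem_right _ _ (Ideal.subset_span ⟨l, by simp, rfl⟩)
  exact := by
    rintro p _ ⟨s, hs, rfl⟩ h0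
    have hs' : s ∈ varIdeal 𝕜 (insert l P) := (Submodule.Quotient.mk_eq_zero _).1 h0
    -- Divide `s` by `x_l`: the terms of the remainder avoid `x_l`, so each of them contains a
    -- variable of `P`.
    refine ⟨Submodule.mkQ _ (s.divMonomial (Finsupp.single l 1)), ⟨_, ?_, rfl⟩, ?_⟩
    · have := divMonomial_mem_polyDegree hs (Finsupp.single l 1)
      rwa [Finsupp.degree_single, Nat.cast_one, sub_sub] at this
    · refine (Submodule.Quotient.eq _).2 ?_
      have h1 := MvPolynomial.divMonomial_add_modMonomial_single s l
      have h2 : MvPolynomial.X l * s.divMonomial (Finsupp.single l 1) - s =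
          - s.modMonomial (Finsupp.single l 1) := by
        rw [sub_eq_iff_eq_add, eq_neg_add_iff_add_eq, add_comm]
        exact h1
      refine (congrArg (· ∈ varIdeal 𝕜 P) h2).mpr (neg_mem (mem_varIdeal.2 fun e he => ?_))
      by_cases hle : Finsupp.single l 1 ≤ e
      · exact absurd (MvPolynomial.coeff_modMonomial_of_le _ hle) he
      · rw [MvPolynomial.coeff_modMonomial_of_not_le _ hle] at he
        obtain ⟨i, hi, hei⟩ := mem_varIdeal.1 hs' e he
        rcases Finset.mem_insert.1 hi with rfl | hi
        · exact absurd (by simpa [Nat.one_le_iff_ne_zero] using hei) hle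
        · exact ⟨i, hi, hei⟩
  surjective := by
    rintro p _ ⟨s, hs, rfl⟩
    exact ⟨_, ⟨s, hs, rfl⟩, rfl⟩

theorem hasBetti_varIdeal (P : Finset (Fin n)) (d : ℤ) :
    HasBetti (quotGrading (varIdeal 𝕜 P) d) fun i j => if j = i + d then P.card.choose i else 0 := by
  classical
  induction P using Finset.induction_on generalizing d with
  | empty =>
    have h : GradedExact (A := PUnit.{u+1}) ⟨fun _ => ⊥, fun _ _ => Subsingleton.elim _ _⟩
        (polyGrading 𝕜 n d) (quotGrading (varIdeal 𝕜 (∅ : Finset (Fin n))) d) 0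
        (Submodule.mkQ _) :=
      { left_mem := fun p a _ => zero_mem _
        right_mem := fun p b hb => ⟨b, hb, rfl⟩
        injective := fun _ _ _ => rfl
        comp_eq_zero := fun _ => rfl
        exact := fun p b _ hb => by
          have hb' : b ∈ varIdeal 𝕜 (∅ : Finset (Fin n)) := (Submodule.Quotient.mk_eq_zero _).1 hb
          refine ⟨0, zero_mem _, ?_⟩
          ext e
          by_contra hne
          obtain ⟨i, hi, -⟩ := mem_varIdeal.1 hb' e (Ne.symm hne)
          simp at hi
        surjective := by
          rintro p _ ⟨s, hs, rfl⟩
          exact ⟨s, hs, rfl⟩ }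
    refine h.hasBetti_right (hasBetti_zero_of_subsingleton _) (hasBetti_polyGrading d)
      (fun _ _ => Or.inl rfl) (fun j => by simp) (fun i j => by simp)
  | insert l P hl ih =>
    -- The two tables live on the lines `j = i + d + 1` and `j = i + d`, which are disjoint; the new
    -- table is Pascal's rule.
    refine (gradedExact_varIdeal hl d).hasBetti_right (ih (d + 1)) (ih d) ?_ ?_ ?_
    · intro i j
      by_cases h : j = i + d
      · exact Or.inl (if_neg (by omega))
      · exact Or.inr (if_neg h)
    · intro j
      simp
    · intro i j
      rw [Finset.card_insert_of_notMem hl, Nat.choose_succ_succ]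
      push_cast
      by_cases h : j = i + 1 + d
      · rw [if_pos h, if_pos h, if_pos (by omega), add_comm]
      · rw [if_neg h, if_neg h, if_neg (by omega)]

/-- The ideal generated by the monomials with exponent in `G`. -/
noncomputable def monomialIdeal (𝕜 : Type u) [Field 𝕜] {n : ℕ} (G : Finset (Fin n →₀ ℕ)) :
    Ideal (MvPolynomial (Fin n) 𝕜) :=
  Ideal.span ((fun e => MvPolynomial.monomial e (1 : 𝕜)) '' (G : Set (Fin n →₀ ℕ)))

theorem mem_monomialIdeal {G : Finset (Fin n →₀ ℕ)} {f : MvPolynomial (Fin n) 𝕜} :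
    f ∈ monomialIdeal 𝕜 G ↔ ∀ e : Fin n →₀ ℕ, f.coeff e ≠ 0 → ∃ a ∈ G, a ≤ e := by
  rw [monomialIdeal, MvPolynomial.mem_ideal_span_monomial_image]
  simp only [MvPolynomial.mem_support_iff, Finset.mem_coe]

theorem monomialIdeal_mono {s t : Finset (Fin n →₀ ℕ)} (h : s ⊆ t) :
    monomialIdeal 𝕜 s ≤ monomialIdeal 𝕜 t :=
  Ideal.span_mono (Set.image_mono (by exact_mod_cast h))

theorem divMonomial_mem_varIdeal {s : Finset (Fin n →₀ ℕ)} {a : Fin n →₀ ℕ} {P : Finset (Fin n)}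
    (h : ∀ b ∈ s, ∃ l ∈ P, a l < b l) {f : MvPolynomial (Fin n) 𝕜} (hf : f ∈ monomialIdeal 𝕜 s) :
    f.divMonomial a ∈ varIdeal 𝕜 P := by
  refine mem_varIdeal.2 fun e he => ?_
  rw [MvPolynomial.coeff_divMonomial] at he
  obtain ⟨b, hb, hle⟩ := mem_monomialIdeal.1 hf _ he
  obtain ⟨l, hl, hlt⟩ := h b hb
  refine ⟨l, hl, ?_⟩
  have := hle l
  rw [Finsupp.add_apply] at this
  omega

theorem modMonomial_mem_monomialIdeal {s : Finset (Fin n →₀ ℕ)} {a : Fin n →₀ ℕ}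
    {f : MvPolynomial (Fin n) 𝕜} (hf : f ∈ monomialIdeal 𝕜 (insert a s)) :
    f.modMonomial a ∈ monomialIdeal 𝕜 s := by
  refine mem_monomialIdeal.2 fun e he => ?_
  by_cases hle : a ≤ e
  · exact absurd (MvPolynomial.coeff_modMonomial_of_le _ hle) he
  · rw [MvPolynomial.coeff_modMonomial_of_not_le _ hle] at he
    obtain ⟨b, hb, hbe⟩ := mem_monomialIdeal.1 hf e he
    rcases Finset.mem_insert.1 hb with rfl | hb
    · exact absurd hbe hle
    · exact ⟨b, hb, hbe⟩

/-- The map `(s) + (x^a) → S/P` which sends `x^a` to `1`, where `P` is the ideal of variables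
which is the colon ideal `(s) : x^a`. -/
noncomputable def colonMap {s : Finset (Fin n →₀ ℕ)} {a : Fin n →₀ ℕ} {P : Finset (Fin n)}
    (h : ∀ b ∈ s, ∃ l ∈ P, a l < b l) :
    monomialIdeal 𝕜 (insert a s) →ₗ[MvPolynomial (Fin n) 𝕜]
      MvPolynomial (Fin n) 𝕜 ⧸ varIdeal 𝕜 P where
  toFun y := (varIdeal 𝕜 P).mkQ (y.1.divMonomial a)
  map_add' y z := by
    rw [Submodule.coe_add, MvPolynomial.add_divMonomial, map_add]
  map_smul' r y := by
    rw [RingHom.id_apply, ← map_smul, ← sub_eq_zero, ← map_sub]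
    refine (Submodule.Quotient.mk_eq_zero _).2 ?_
    have h1 : r * y.1 = MvPolynomial.monomial a 1 * (r * y.1.divMonomial a) +
        r * y.1.modMonomial a := by
      conv_lhs => rw [← MvPolynomial.divMonomial_add_modMonomial y.1 a]
      ring
    have h2 : (r • y : monomialIdeal 𝕜 (insert a s)).1.divMonomial a - r • y.1.divMonomial a =
        (r * y.1.modMonomial a).divMonomial a := by
      rw [Submodule.coe_smul, smul_eq_mul, smul_eq_mul, h1, MvPolynomial.add_divMonomial,
        MvPolynomial.divMonomial_monomial_mul, add_sub_cancel_left]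
    rw [h2]
    exact divMonomial_mem_varIdeal h (Ideal.mul_mem_left _ _ (modMonomial_mem_monomialIdeal y.2))

/-- The hypotheses are the two inclusions between the colon ideal `(s) : x^a` and the ideal of the
variables in `P`: `h` bounds the colon ideal from above, `h'` puts each variable into it. -/
theorem gradedExact_insert {s : Finset (Fin n →₀ ℕ)} {a : Fin n →₀ ℕ} {P : Finset (Fin n)}
    (h : ∀ b ∈ s, ∃ l ∈ P, a l < b l) (h' : ∀ l ∈ P, ∃ b ∈ s, b ≤ a + Finsupp.single l 1) :
    GradedExact (idealGrading (monomialIdeal 𝕜 s)) (idealGrading (monomialIdeal 𝕜 (insert a s)))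
      (quotGrading (varIdeal 𝕜 P) a.degree)
      (Submodule.inclusion (monomialIdeal_mono (Finset.subset_insert a s))) (colonMap h) where
  left_mem := fun p x hx => hx
  right_mem := fun p x hx => ⟨_, divMonomial_mem_polyDegree hx a, rfl⟩
  injective := Submodule.inclusion_injective _
  comp_eq_zero := fun x =>
    (Submodule.Quotient.mk_eq_zero _).2 (divMonomial_mem_varIdeal h x.2)
  exact := by
    intro p x hx h0
    have h0' : x.1.divMonomial a ∈ varIdeal 𝕜 P := (Submodule.Quotient.mk_eq_zero _).1 h0
    refine ⟨⟨x.1, mem_monomialIdeal.2 fun e he => ?_⟩, hx, rfl⟩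
    by_cases hae : a ≤ e
    · obtain ⟨e, rfl⟩ := exists_add_of_le hae
      rw [← MvPolynomial.coeff_divMonomial] at he
      obtain ⟨l, hl, hle⟩ := mem_varIdeal.1 h0' e he
      obtain ⟨b, hb, hba⟩ := h' l hl
      refine ⟨b, hb, hba.trans (add_le_add_right ?_ _)⟩
      simpa [Nat.one_le_iff_ne_zero] using hle
    · obtain ⟨b, hb, hbe⟩ := mem_monomialIdeal.1 x.2 e he
      rcases Finset.mem_insert.1 hb with rfl | hb
      · exact absurd hbe hae
      · exact ⟨b, hb, hbe⟩
  surjective := by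
    rintro p _ ⟨t, ht, rfl⟩
    refine ⟨⟨MvPolynomial.monomial a 1 * t, Ideal.mul_mem_right _ _
      (Ideal.subset_span ⟨a, by simp, rfl⟩)⟩, ?_, ?_⟩
    · have := mul_mem_polyDegree (monomial_mem_polyDegree a (1 : 𝕜)) ht
      rw [add_sub_cancel] at this
      exact this
    · change (varIdeal 𝕜 P).mkQ ((MvPolynomial.monomial a 1 * t).divMonomial a) = _
      rw [MvPolynomial.divMonomial_monomial_mul]
      rfl

/-- The Betti numbers of a monomial ideal with linear quotients. -/
theorem hasBetti_monomialIdeal {κ : Type*} [LinearOrder κ] (G : Finset (Fin n →₀ ℕ))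
    (key : (Fin n →₀ ℕ) → κ) (P : (Fin n →₀ ℕ) → Finset (Fin n))
    (h1 : ∀ a ∈ G, ∀ l ∈ P a, ∃ b ∈ G, key b < key a ∧ b ≤ a + Finsupp.single l 1)
    (h2 : ∀ a ∈ G, ∀ b ∈ G, a ≠ b → key b ≤ key a → ∃ l ∈ P a, a l < b l)
    (h3 : ∀ a ∈ G, ∀ b ∈ G, key b ≤ key a → b.degree ≤ a.degree) :
    HasBetti (idealGrading (monomialIdeal 𝕜 G)) fun i j =>
      ∑ a ∈ G, if j = i + (a.degree : ℤ) then (P a).card.choose i else 0 := by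
  induction G using Finset.induction_on_max_value key with
  | empty =>
    have : Subsingleton (monomialIdeal 𝕜 (∅ : Finset (Fin n →₀ ℕ))) := by
      rw [Submodule.subsingleton_iff_eq_bot]
      simp [monomialIdeal]
    simpa using hasBetti_zero_of_subsingleton (idealGrading (monomialIdeal 𝕜 ∅))
  | insert a s has hmax ih =>
    have hs : ∀ b ∈ s, b ∈ insert a s := fun b hb => Finset.mem_insert_of_mem hb
    have ha : a ∈ insert a s := Finset.mem_insert_self a s
    -- The strict inequality in `h1` keeps its witnesses among the generators already adjoined.
    have hlt : ∀ b ∈ insert a s, key b < key a → b ∈ s := fun b hb hlt => by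
      rcases Finset.mem_insert.1 hb with rfl | hb
      · exact absurd hlt (lt_irrefl _)
      · exact hb
    have ih' := ih
      (fun b hb l hl => by
        obtain ⟨b', hb', hk, hle⟩ := h1 b (hs b hb) l hl
        exact ⟨b', hlt b' hb' (hk.trans_le (hmax b hb)), hk, hle⟩)
      (fun b hb b' hb' => h2 b (hs b hb) b' (hs b' hb'))
      (fun b hb b' hb' => h3 b (hs b hb) b' (hs b' hb'))
    have hex := gradedExact_insert (𝕜 := 𝕜) (s := s) (a := a) (P := P a)
      (fun b hb => h2 a ha b (hs b hb) (fun h => has (h ▸ hb)) (hmax b hb))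
      (fun l hl => by
        obtain ⟨b, hb, hk, hle⟩ := h1 a ha l hl
        exact ⟨b, hlt b hb hk, hle⟩)
    have := hex.hasBetti_middle ih' (hasBetti_varIdeal (P a) a.degree) ?_
    · simpa only [Finset.sum_insert has, add_comm] using this
    -- The quotient has Tor in homological degree `i + 1` only in degree `i + 1 + deg a`, while the
    -- earlier generators have degree at most `deg a` and reach at most `i + deg a` in homological
    -- degree `i`.
    · intro i j
      by_cases hj : j = ((i + 1 : ℕ) : ℤ) + a.degree
      · refine Or.inr (Finset.sum_eq_zero fun b hb => if_neg ?_)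
        have := h3 a ha b (hs b hb) (hmax b hb)
        omega
      · exact Or.inl (if_neg hj)

end LinearQuotients

end StarConfiguration

namespace StarConfiguration

/-! ### Minimal generators of the symbolic power and their colon ideals. -/

section Generators

variable {n c m : ℕ}

/-- `a` is the exponent of a minimal generator of `I_{n,c}^{(m)}` with largest entry `k`. -/
def IsGen (n c m k : ℕ) (a : Fin n →₀ ℕ) : Prop :=
  (∀ i, a i ≤ k) ∧ n - c + 1 ≤ (Finset.univ.filter fun i => a i = k).card ∧
    ∑ i, a i = m + (n - c) * k

/-- The largest exponent. -/
def maxVal (a : Fin n →₀ ℕ) : ℕ := Finset.univ.sup a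

theorem le_maxVal (a : Fin n →₀ ℕ) (i : Fin n) : a i ≤ maxVal a :=
  Finset.le_sup (f := a) (Finset.mem_univ i)

theorem IsGen.exists_eq {k : ℕ} {a : Fin n →₀ ℕ} (h : IsGen n c m k a) : ∃ i, a i = k := by
  obtain ⟨i, hi⟩ := Finset.card_pos.1 (lt_of_lt_of_le (Nat.succ_pos _) h.2.1)
  exact ⟨i, by simpa using hi⟩

theorem IsGen.maxVal_eq {k : ℕ} {a : Fin n →₀ ℕ} (h : IsGen n c m k a) : maxVal a = k := by
  apply le_antisymm
  · exact Finset.sup_le fun i _ => h.1 i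
  · obtain ⟨i, hi⟩ := h.exists_eq
    exact hi ▸ le_maxVal a i

theorem IsGen.mul_le {k : ℕ} {a : Fin n →₀ ℕ} (h : IsGen n c m k a) :
    (Finset.univ.filter fun i => a i = k).card * k ≤ m + (n - c) * k := by
  rw [← h.2.2, ← smul_eq_mul, ← Finset.sum_const]
  calc _ = ∑ i ∈ Finset.univ.filter fun i => a i = k, a i :=
        Finset.sum_congr rfl fun i hi => (Finset.mem_filter.1 hi).2.symm
    _ ≤ _ := Finset.sum_le_sum_of_subset (Finset.subset_univ _)

theorem IsGen.le {k : ℕ} {a : Fin n →₀ ℕ} (h : IsGen n c m k a) : k ≤ m := by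
  have h1 := h.mul_le
  have h2 := Nat.mul_le_mul_right k h.2.1
  rw [add_mul, one_mul] at h2
  omega

theorem IsGen.pos {k : ℕ} {a : Fin n →₀ ℕ} (hm : 1 ≤ m) (h : IsGen n c m k a) : 1 ≤ k := by
  by_contra hk
  obtain rfl : k = 0 := by omega
  have := h.2.2
  rw [Finset.sum_eq_zero fun i _ => Nat.le_zero.1 (h.1 i)] at this
  omega

/-- The exponents of the minimal generators of `I_{n,c}^{(m)}`. -/
noncomputable def gens (n c m : ℕ) : Finset (Fin n →₀ ℕ) :=
  Set.Finite.toFinset (s := {a | IsGen n c m (maxVal a) a})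
    ((Set.finite_Iic (Finsupp.equivFunOnFinite.symm fun _ : Fin n => m)).subset
      fun a ha i => (le_maxVal a i).trans (IsGen.le ha))

theorem mem_gens {a : Fin n →₀ ℕ} : a ∈ gens n c m ↔ IsGen n c m (maxVal a) a := by
  simp [gens]

theorem IsGen.mem_gens {k : ℕ} {a : Fin n →₀ ℕ} (h : IsGen n c m k a) : a ∈ gens n c m :=
  StarConfiguration.mem_gens.2 (h.maxVal_eq.symm ▸ h)

/-- The variables which generate the colon ideal of the generator with exponent `a`. -/
def colonVars (a : Fin n →₀ ℕ) : Finset (Fin n) :=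
  Finset.univ.filter fun i => a i + 1 < maxVal a ∨
    (a i + 1 = maxVal a ∧ ∃ j, i < j ∧ a j = maxVal a)

/-- The order of the generators. -/
def genKey (a : Fin n →₀ ℕ) : ℕ ×ₗ ℕ ×ₗ ℕ :=
  toLex (maxVal a, toLex (∑ i, a i ^ 2, ∑ i : Fin n, (i : ℕ) * a i))

theorem maxVal_le_of_genKey_le {a b : Fin n →₀ ℕ} (h : genKey b ≤ genKey a) :
    maxVal b ≤ maxVal a := by
  rw [genKey, genKey, Prod.Lex.toLex_le_toLex] at h
  rcases h with h | h
  · exact h.le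
  · exact h.1.le

theorem sum_le_of_genKey_le {a b : Fin n →₀ ℕ} (h : genKey b ≤ genKey a)
    (hk : maxVal b = maxVal a) : ∑ i, b i ^ 2 < ∑ i, a i ^ 2 ∨ (∑ i, b i ^ 2 = ∑ i, a i ^ 2 ∧
      ∑ i : Fin n, (i : ℕ) * b i ≤ ∑ i : Fin n, (i : ℕ) * a i) := by
  rw [genKey, genKey, Prod.Lex.toLex_le_toLex] at h
  rcases h with h | h
  · exact absurd hk h.ne
  · exact Prod.Lex.toLex_le_toLex.1 h.2

theorem genKey_lt_of_maxVal_lt {a b : Fin n →₀ ℕ} (h : maxVal b < maxVal a) :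
    genKey b < genKey a :=
  Prod.Lex.toLex_lt_toLex.2 (Or.inl h)

theorem genKey_lt_of_sum_lt {a b : Fin n →₀ ℕ} (hk : maxVal b = maxVal a)
    (h : ∑ i, b i ^ 2 < ∑ i, a i ^ 2 ∨ (∑ i, b i ^ 2 = ∑ i, a i ^ 2 ∧
      ∑ i : Fin n, (i : ℕ) * b i < ∑ i : Fin n, (i : ℕ) * a i)) : genKey b < genKey a :=
  Prod.Lex.toLex_lt_toLex.2 (Or.inr ⟨hk, Prod.Lex.toLex_lt_toLex.2 h⟩)

theorem sum_add_eq_of_eq_off {u v : Fin n → ℕ} {l j : Fin n} (hlj : l ≠ j)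
    (h : ∀ i, i ≠ l → i ≠ j → u i = v i) : ∑ i, u i + (v l + v j) = ∑ i, v i + (u l + u j) := by
  have key : ∀ w : Fin n → ℕ, ∑ i, w i = w l + (w j + ∑ i ∈ (Finset.univ.erase l).erase j, w i) :=
    fun w => by
      rw [Finset.add_sum_erase _ _ (by simp [hlj.symm]), Finset.add_sum_erase _ _ (by simp)]
  rw [key u, key v, Finset.sum_congr rfl fun i hi => ?_]
  · ring
  · simp only [Finset.mem_erase] at hi
    exact h i hi.2.1 hi.1

/-- Moving one unit from the largest entry `a j` to `a l`. -/
theorem exists_move {a : Fin n →₀ ℕ} {k : ℕ} {l j : Fin n} (hlj : l ≠ j) (hl : a l + 1 ≤ k)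
    (hj : a j = k) :
    ∃ b : Fin n →₀ ℕ, b ≤ a + Finsupp.single l 1 ∧ b l = a l + 1 ∧ b j = k - 1 ∧
      ∀ i, i ≠ l → i ≠ j → b i = a i := by
  refine ⟨(a.update l (a l + 1)).update j (k - 1), fun i => ?_, ?_, ?_, ?_⟩
  · rw [Finsupp.coe_update, Finsupp.coe_update, Finsupp.add_apply]
    by_cases hij : i = j
    · subst hij
      rw [Function.update_self]
      omega
    · by_cases hil : i = l
      · subst hil
        rw [Function.update_of_ne hij, Function.update_self, Finsupp.single_eq_same]
      · rw [Function.update_of_ne hij, Function.update_of_ne hil]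
        omega
  · rw [Finsupp.coe_update, Finsupp.coe_update, Function.update_of_ne hlj, Function.update_self]
  · rw [Finsupp.coe_update, Function.update_self]
  · intro i hil hij
    rw [Finsupp.coe_update, Finsupp.coe_update, Function.update_of_ne hij,
      Function.update_of_ne hil]

/-- If there are exactly `n - c + 1` entries `k`, all of them are lowered by one while `a l` is
raised by one, which makes the maximum `k - 1`. Otherwise one unit moves from a single maximal entry
to `a l`, which lowers the sum of squares. -/
theorem IsGen.exists_lt_of_lt {a : Fin n →₀ ℕ} {k : ℕ} (ha : IsGen n c m k a) {l : Fin n}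
    (hl : a l + 1 < k) :
    ∃ b, b ∈ gens n c m ∧ genKey b < genKey a ∧ b ≤ a + Finsupp.single l 1 := by
  rcases eq_or_lt_of_le ha.2.1 with hM | hM
  · let b : Fin n →₀ ℕ := Finsupp.equivFunOnFinite.symm fun i =>
      if a i = k then k - 1 else (a + Finsupp.single l 1 : Fin n →₀ ℕ) i
    have hb : ∀ i, b i = if a i = k then k - 1 else (a + Finsupp.single l 1 : Fin n →₀ ℕ) i := fun i => rfl
    -- This is exactly the degree needed for maximum `k - 1`: one unit gained and `n - c + 1` lost
    -- change the sum by `-(n - c)`.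
    have hsum : ∑ i, b i + (n - c + 1) = ∑ i, a i + 1 := by
      have h1 : ∑ i, (b i + if a i = k then 1 else 0) = ∑ i, (a + Finsupp.single l 1 : Fin n →₀ ℕ) i := by
        refine Finset.sum_congr rfl fun i _ => ?_
        rw [hb]
        split_ifs with h
        · have hil : l ≠ i := by rintro rfl; omega
          rw [Finsupp.add_apply, Finsupp.single_eq_of_ne hil.symm, h]
          omega
        · rfl
      rw [Finset.sum_add_distrib, Finset.sum_boole, ← hM] at h1
      simpa [Finset.sum_add_distrib, Finsupp.single_apply] using h1
    have hgen : IsGen n c m (k - 1) b := by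
      refine ⟨fun i => ?_, hM.le.trans (Finset.card_le_card fun i hi => ?_), ?_⟩
      · rw [hb]
        split_ifs with h
        · exact le_rfl
        · have := ha.1 i
          rw [Finsupp.add_apply, Finsupp.single_apply]
          split_ifs with h'
          · subst h'; omega
          · omega
      · rw [Finset.mem_filter] at hi ⊢
        exact ⟨hi.1, by rw [hb, if_pos hi.2]⟩
      · rw [ha.2.2] at hsum
        obtain ⟨k, rfl⟩ : ∃ k', k = k' + 1 := ⟨k - 1, by omega⟩
        rw [mul_add, mul_one] at hsum
        rw [Nat.add_sub_cancel]
        omega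
    refine ⟨b, hgen.mem_gens, genKey_lt_of_maxVal_lt ?_, fun i => ?_⟩
    · rw [hgen.maxVal_eq, ha.maxVal_eq]
      omega
    · rw [hb]
      split_ifs with h
      · rw [Finsupp.add_apply]; omega
      · exact le_rfl
  · obtain ⟨j, hj⟩ := ha.exists_eq
    have hlj : l ≠ j := by rintro rfl; omega
    obtain ⟨b, hba, hbl, hbj, hb⟩ := exists_move hlj hl.le hj
    have hsum := sum_add_eq_of_eq_off (u := b) (v := a) hlj hb
    have hsq := sum_add_eq_of_eq_off (u := fun i => b i ^ 2) (v := fun i => a i ^ 2) hlj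
      fun i h h' => by rw [hb i h h']
    have hgen : IsGen n c m k b := by
      refine ⟨fun i => ?_, ?_, ?_⟩
      · by_cases hil : i = l
        · subst hil; omega
        · by_cases hij : i = j
          · subst hij; omega
          · rw [hb i hil hij]; exact ha.1 i
      · have hsub : (Finset.univ.filter fun i => a i = k).erase j ⊆
            Finset.univ.filter fun i => b i = k := by
          intro i hi
          rw [Finset.mem_erase, Finset.mem_filter] at hi
          rw [Finset.mem_filter, hb i _ hi.1]
          · exact hi.2
          · rintro rfl; omega
        have := Finset.card_le_card hsub
        rw [Finset.card_erase_of_mem (by simpa using hj)] at this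
        omega
      · rw [← ha.2.2]; omega
    refine ⟨b, hgen.mem_gens, genKey_lt_of_sum_lt ?_ (Or.inl ?_), hba⟩
    · rw [hgen.maxVal_eq, ha.maxVal_eq]
    · simp only [hbl, hbj, hj] at hsq
      obtain ⟨q, rfl⟩ : ∃ q, k = a l + 2 + q := ⟨k - (a l + 2), by omega⟩
      rw [show a l + 2 + q - 1 = a l + 1 + q by omega] at hsq
      nlinarith

/-- Moving one unit here swaps the entries `k - 1` and `k`. The sum of squares is unchanged and `∑ i
* a_i` drops by `j - l`, which is why the order needs its third component. -/
theorem IsGen.exists_lt_of_eq {a : Fin n →₀ ℕ} {k : ℕ} (ha : IsGen n c m k a) {l j : Fin n}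
    (hl : a l + 1 = k) (hlj : l < j) (hj : a j = k) :
    ∃ b, b ∈ gens n c m ∧ genKey b < genKey a ∧ b ≤ a + Finsupp.single l 1 := by
  obtain ⟨b, hba, hbl, hbj, hb⟩ := exists_move hlj.ne hl.le hj
  have hsum := sum_add_eq_of_eq_off (u := b) (v := a) hlj.ne hb
  have hsq := sum_add_eq_of_eq_off (u := fun i => b i ^ 2) (v := fun i => a i ^ 2) hlj.ne
    fun i h h' => by rw [hb i h h']
  have hpos := sum_add_eq_of_eq_off (u := fun i => (i : ℕ) * b i) (v := fun i => (i : ℕ) * a i)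
    hlj.ne fun i h h' => by rw [hb i h h']
  have hgen : IsGen n c m k b := by
    refine ⟨fun i => ?_, ?_, ?_⟩
    · by_cases hil : i = l
      · subst hil; omega
      · by_cases hij : i = j
        · subst hij; omega
        · rw [hb i hil hij]; exact ha.1 i
    · have hsub : insert l ((Finset.univ.filter fun i => a i = k).erase j) ⊆
          Finset.univ.filter fun i => b i = k := by
        intro i hi
        rw [Finset.mem_insert, Finset.mem_erase, Finset.mem_filter] at hi
        rw [Finset.mem_filter]
        refine ⟨Finset.mem_univ _, ?_⟩
        rcases hi with rfl | hi
        · omega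
        · rw [hb i _ hi.1]
          · exact hi.2.2
          · rintro rfl; omega
      have := Finset.card_le_card hsub
      rw [Finset.card_insert_of_notMem, Finset.card_erase_of_mem (by simpa using hj)] at this
      · have := ha.2.1
        omega
      · simp only [Finset.mem_erase, Finset.mem_filter]
        omega
    · rw [← ha.2.2]; omega
  refine ⟨b, hgen.mem_gens, genKey_lt_of_sum_lt ?_ (Or.inr ⟨?_, ?_⟩), hba⟩
  · rw [hgen.maxVal_eq, ha.maxVal_eq]
  · simp only [hbl, hbj, hj, hl] at hsq
    rw [show a l = k - 1 by omega] at hsq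
    omega
  · simp only [hbl, hbj, hj, hl] at hpos
    rw [show a l = k - 1 by omega] at hpos
    obtain ⟨k, rfl⟩ : ∃ k', k = k' + 1 := ⟨k - 1, by omega⟩
    have : (l : ℕ) < j := hlj
    rw [Nat.add_sub_cancel] at hpos
    nlinarith

theorem exists_genKey_lt {a : Fin n →₀ ℕ} (ha : a ∈ gens n c m) {l : Fin n}
    (hl : l ∈ colonVars a) :
    ∃ b ∈ gens n c m, genKey b < genKey a ∧ b ≤ a + Finsupp.single l 1 := by
  rw [mem_gens] at ha
  rw [colonVars, Finset.mem_filter] at hl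
  rcases hl.2 with h | ⟨h, j, hj, hja⟩
  · exact ha.exists_lt_of_lt h
  · exact ha.exists_lt_of_eq h hj hja

/-- Where `b` exceeds `a`, the index is not a colon variable, so the entry goes from `k - 1` to `k`,
at or after the last maximal position `jm` of `a`. Two sums of nonnegative terms, one for the
squares and one for the positions, are forced to vanish and leave no room for a difference. -/
theorem IsGen.eq_of_le_on_colonVars {a b : Fin n →₀ ℕ} {k : ℕ} (ha : IsGen n c m k a)
    (hb : IsGen n c m k b) (hab : ∀ l ∈ colonVars a, b l ≤ a l) (hkey : genKey b ≤ genKey a) :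
    b = a := by
  classical
  obtain ⟨jm, hjm, hmax⟩ := Finset.exists_max_image (Finset.univ.filter fun i => a i = k) id
    (by obtain ⟨i, hi⟩ := ha.exists_eq; exact ⟨i, by simpa using hi⟩)
  rw [Finset.mem_filter] at hjm
  have hsmall : ∀ i, a i + 1 < k → b i ≤ a i := fun i hi => hab i (by
    rw [colonVars, Finset.mem_filter, ha.maxVal_eq]
    exact ⟨Finset.mem_univ _, Or.inl hi⟩)
  have hmid : ∀ i, a i + 1 = k → i < jm → b i ≤ a i := fun i hi hlt => hab i (by
    rw [colonVars, Finset.mem_filter, ha.maxVal_eq]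
    exact ⟨Finset.mem_univ _, Or.inr ⟨hi, jm, hlt, hjm.2⟩⟩)
  have hdeg : ∑ i, ((b i : ℤ) - a i) = 0 := by
    rw [Finset.sum_sub_distrib, sub_eq_zero]
    exact_mod_cast hb.2.2.trans ha.2.2.symm
  -- As `a` and `b` have equal sums, a multiple of `b i - a i` may be added to `b i ^ 2 - a i ^ 2`
  -- without changing the total. The constant `1 - 2 * k` makes the term zero for a step from `k -
  -- 1` to `k` and nonnegative for every decrease.
  have hT : ∀ i, 0 ≤ ((b i : ℤ) - a i) * (a i + b i - 2 * k + 1) := by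
    intro i
    have h1 := ha.1 i
    have h2 := hb.1 i
    rcases le_or_gt (b i) (a i) with h | h
    · rcases eq_or_lt_of_le h with h | h
      · rw [h]; simp
      · refine mul_nonneg_of_nonpos_of_nonpos ?_ ?_ <;> omega
    · have := hsmall i
      rw [show (a i : ℤ) + b i - 2 * k + 1 = 0 by omega, mul_zero]
  have hTsum : ∑ i, ((b i : ℤ) - a i) * (a i + b i - 2 * k + 1) =
      ∑ i, (b i : ℤ) ^ 2 - ∑ i, (a i : ℤ) ^ 2 := by
    have : ∀ i, ((b i : ℤ) - a i) * (a i + b i - 2 * k + 1) =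
        ((b i : ℤ) ^ 2 - (a i : ℤ) ^ 2) + ((b i : ℤ) - a i) * (1 - 2 * k) := fun i => by ring
    simp only [this]
    rw [Finset.sum_add_distrib, ← Finset.sum_mul, hdeg, zero_mul, add_zero,
      Finset.sum_sub_distrib]
  have hT0 := Finset.sum_nonneg fun i (_ : i ∈ Finset.univ) => hT i
  have hle := sum_le_of_genKey_le hkey (hb.maxVal_eq.trans ha.maxVal_eq.symm)
  have hsq : ∑ i, ((b i : ℤ) - a i) * (a i + b i - 2 * k + 1) = 0 := by
    refine le_antisymm ?_ hT0
    rw [hTsum, sub_nonpos]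
    rcases hle with h | h
    · exact_mod_cast h.le
    · exact_mod_cast h.1.le
  have hpos : ∑ i : Fin n, ((i : ℕ) : ℤ) * b i ≤ ∑ i : Fin n, ((i : ℕ) : ℤ) * a i := by
    rcases hle with h | h
    · rw [hTsum, sub_eq_zero] at hsq
      exact absurd (by exact_mod_cast hsq) h.ne
    · exact_mod_cast h.2
  have hTi : ∀ i, ((b i : ℤ) - a i) * (a i + b i - 2 * k + 1) = 0 := fun i =>
    (Finset.sum_eq_zero_iff_of_nonneg fun i _ => hT i).1 hsq i (Finset.mem_univ i)
  -- By `hTi` an entry can now only fall from `k` to `k - 1`, hence at a position at most `jm`, and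
  -- can only rise at a position at least `jm`.
  have hQ : ∀ i : Fin n, 0 ≤ (((i : ℕ) : ℤ) - jm) * ((b i : ℤ) - a i) := by
    intro i
    have h1 := ha.1 i
    have h2 := hb.1 i
    rcases lt_trichotomy (b i) (a i) with h | h | h
    · have h3 : (a i : ℤ) + b i - 2 * k + 1 = 0 :=
        (mul_eq_zero.1 (hTi i)).resolve_left (by omega)
      have : i ≤ jm := hmax i (by simp; omega)
      have : (i : ℕ) ≤ jm := this
      refine mul_nonneg_of_nonpos_of_nonpos ?_ ?_ <;> omega
    · rw [h]; simp
    · have h3 := hsmall i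
      have h4 := hmid i
      have : jm ≤ i := by
        by_contra hlt
        have := h4 (by omega) (not_le.1 hlt)
        omega
      have : (jm : ℕ) ≤ i := this
      refine mul_nonneg ?_ ?_ <;> omega
  have hQsum : ∑ i : Fin n, (((i : ℕ) : ℤ) - jm) * ((b i : ℤ) - a i) = 0 := by
    refine le_antisymm ?_ (Finset.sum_nonneg fun i _ => hQ i)
    have : ∀ i : Fin n, (((i : ℕ) : ℤ) - jm) * ((b i : ℤ) - a i) =
        (((i : ℕ) : ℤ) * b i - ((i : ℕ) : ℤ) * a i) - jm * ((b i : ℤ) - a i) := fun i => by ring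
    simp only [this]
    rw [Finset.sum_sub_distrib, ← Finset.mul_sum, hdeg, mul_zero, sub_zero,
      Finset.sum_sub_distrib]
    exact sub_nonpos.2 hpos
  have hQi : ∀ i : Fin n, (((i : ℕ) : ℤ) - jm) * ((b i : ℤ) - a i) = 0 := fun i =>
    (Finset.sum_eq_zero_iff_of_nonneg fun i _ => hQ i).1 hQsum i (Finset.mem_univ i)
  have hne : ∀ i, i ≠ jm → (b i : ℤ) - a i = 0 := fun i hi =>
    (mul_eq_zero.1 (hQi i)).resolve_left fun h => hi (Fin.ext (by omega))
  have hj : (b jm : ℤ) - a jm = 0 := by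
    rw [← hdeg]
    exact (Finset.sum_eq_single jm (fun i _ hi => hne i hi) (by simp)).symm
  ext i
  by_cases hi : i = jm
  · subst hi; omega
  · have := hne i hi; omega

theorem exists_lt_of_genKey_le {a b : Fin n →₀ ℕ} (ha : a ∈ gens n c m) (hb : b ∈ gens n c m)
    (hab : a ≠ b) (hkey : genKey b ≤ genKey a) : ∃ l ∈ colonVars a, a l < b l := by
  rw [mem_gens] at ha hb
  by_contra! h
  have hk := maxVal_le_of_genKey_le hkey
  rcases eq_or_lt_of_le hk with hk | hk
  · rw [hk] at hb
    exact hab (ha.eq_of_le_on_colonVars hb h hkey).symm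
  · set k := maxVal a with hka
    set k' := maxVal b with hkb
    -- Entries of `a` equal to `k - 1` need no hypothesis, since `b i ≤ k' ≤ k - 1`. Summing, the at
    -- least `n - c + 1` maximal entries lose more than the degree difference `(n - c) * (k - k')`.
    have hle : ∀ i, b i + (if a i = k then k - k' else 0) ≤ a i := by
      intro i
      have h1 := ha.1 i
      have h2 := hb.1 i
      split_ifs with hi
      · omega
      · by_cases h3 : a i + 1 < k
        · exact h i (by rw [colonVars, Finset.mem_filter]; exact ⟨Finset.mem_univ _, Or.inl h3⟩)
        · omega
    have hsum := Finset.sum_le_sum fun i (_ : i ∈ Finset.univ) => hle i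
    rw [Finset.sum_add_distrib, ha.2.2, hb.2.2, ← Finset.sum_filter, Finset.sum_const,
      smul_eq_mul] at hsum
    have h3 := Nat.mul_le_mul_right (k - k') ha.2.1
    obtain ⟨q, hq⟩ : ∃ q, k = k' + q := ⟨k - k', by omega⟩
    rw [hq] at hsum h3
    rw [Nat.add_sub_cancel_left] at hsum h3
    rw [add_mul, one_mul] at h3
    rw [mul_add] at hsum
    omega

theorem degree_gen {a : Fin n →₀ ℕ} (ha : a ∈ gens n c m) :
    a.degree = m + (n - c) * maxVal a := by
  rw [mem_gens] at ha
  rw [Finsupp.degree_eq_sum, ha.2.2]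

/-- The exponents of the monomials in `I_{n,c}^{(m)}`. -/
def IsStarExponent (c m : ℕ) (e : Fin n →₀ ℕ) : Prop :=
  ∀ s : Finset (Fin n), s.card = c → m ≤ ∑ i ∈ s, e i

theorem IsGen.isStarExponent {k : ℕ} {a : Fin n →₀ ℕ} (ha : IsGen n c m k a) :
    IsStarExponent c m a := by
  intro s hs
  have h1 := Finset.sum_add_sum_compl s a
  have h2 : ∑ i ∈ sᶜ, a i ≤ (n - c) * k := by
    refine (Finset.sum_le_card_nsmul _ _ k fun i _ => ha.1 i).trans ?_
    rw [Finset.card_compl, Fintype.card_fin, hs, smul_eq_mul]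
  rw [ha.2.2] at h1
  omega

theorem exists_gen_le (hc : 1 ≤ c) (hcn : c ≤ n) (hm : 1 ≤ m) {e : Fin n →₀ ℕ}
    (he : IsStarExponent c m e) : ∃ a ∈ gens n c m, a ≤ e := by
  classical
  obtain ⟨a, hae, ha, hmin⟩ := exists_minimal_le_of_wellFoundedLT (IsStarExponent c m) e he
  refine ⟨a, ?_, hae⟩
  obtain ⟨j, -, hj⟩ := Finset.exists_max_image (Finset.univ : Finset (Fin n)) a
    ⟨⟨0, by omega⟩, Finset.mem_univ _⟩
  have hjpos : 0 < a j := by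
    by_contra h0
    obtain ⟨s, -, hs⟩ := Finset.exists_subset_card_eq (s := (Finset.univ : Finset (Fin n)))
      (n := c) (by simpa using hcn)
    have := ha s hs
    rw [Finset.sum_eq_zero fun i _ => by have := hj i (Finset.mem_univ _); omega] at this
    omega
  have hsub : Finsupp.single j 1 ≤ a := by simpa [Nat.one_le_iff_ne_zero] using hjpos.ne'
  have hadd : a - Finsupp.single j 1 + Finsupp.single j 1 = a := tsub_add_cancel_of_le hsub
  have hnot : ¬ IsStarExponent c m (a - Finsupp.single j 1) := by
    intro h
    have := hmin h tsub_le_self j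
    rw [Finsupp.tsub_apply, Finsupp.single_eq_same] at this
    omega
  obtain ⟨s, hs, hlt⟩ : ∃ s : Finset (Fin n), s.card = c ∧
      ∑ i ∈ s, (a - Finsupp.single j 1 : Fin n →₀ ℕ) i < m := by
    simpa [IsStarExponent] using hnot
  have hsum : ∑ i ∈ s, a i = ∑ i ∈ s, (a - Finsupp.single j 1 : Fin n →₀ ℕ) i +
      if j ∈ s then 1 else 0 := by
    conv_lhs => rw [← hadd]
    simp only [Finsupp.add_apply, Finset.sum_add_distrib, Finsupp.single_apply,
      Finset.sum_ite_eq]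
  have has := ha s hs
  have hjs : j ∈ s := by
    by_contra hjs
    rw [if_neg hjs] at hsum
    omega
  rw [if_pos hjs] at hsum
  -- The sum over `s` is exactly `m`, so exchanging `j` for an outside index `i` cannot lower it;
  -- since `a j` is maximal, equality follows.
  have hout : ∀ i, i ∉ s → a i = a j := by
    intro i hi
    refine le_antisymm (hj i (Finset.mem_univ _)) ?_
    have h1 := ha (insert i (s.erase j)) (by
      rw [Finset.card_insert_of_notMem (by simp [hi]), Finset.card_erase_of_mem hjs]
      omega)
    rw [Finset.sum_insert (by simp [hi])] at h1
    have h2 := Finset.add_sum_erase s a hjs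
    omega
  have hgen : IsGen n c m (a j) a := by
    refine ⟨fun i => hj i (Finset.mem_univ _), ?_, ?_⟩
    · have hsub : insert j sᶜ ⊆ Finset.univ.filter fun i => a i = a j := by
        intro i hi
        rw [Finset.mem_filter]
        refine ⟨Finset.mem_univ _, ?_⟩
        rcases Finset.mem_insert.1 hi with rfl | hi
        · rfl
        · exact hout i (Finset.mem_compl.1 hi)
      have := Finset.card_le_card hsub
      rwa [Finset.card_insert_of_notMem (by simpa using hjs), Finset.card_compl, Fintype.card_fin,
        hs] at this
    · rw [← Finset.sum_add_sum_compl s a, Finset.sum_congr rfl fun i hi =>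
        hout i (Finset.mem_compl.1 hi), Finset.sum_const, Finset.card_compl, Fintype.card_fin, hs,
        smul_eq_mul]
      omega
  exact hgen.mem_gens

end Generators

end StarConfiguration

namespace StarConfiguration

/-! ### The symbolic power as a monomial ideal, and its Betti numbers. -/

section StarIdeal

variable {𝕜 : Type u} [Field 𝕜] {n c m : ℕ}

theorem mem_span_X_pow (s : Finset (Fin n)) (m : ℕ) (f : MvPolynomial (Fin n) 𝕜) :
    f ∈ Ideal.span ((fun i => (MvPolynomial.X i : MvPolynomial (Fin n) 𝕜)) '' (s : Set (Fin n))) ^ m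
      ↔ ∀ e : Fin n →₀ ℕ, f.coeff e ≠ 0 → m ≤ ∑ i ∈ s, e i := by
  classical
  constructor
  · intro hf
    induction m generalizing f with
    | zero => exact fun _ _ => Nat.zero_le _
    | succ m ih =>
      rw [pow_succ] at hf
      refine Submodule.mul_induction_on hf ?_ ?_
      · intro g hg h hh e he
        rw [MvPolynomial.coeff_mul] at he
        obtain ⟨⟨p, q⟩, hpq, hne⟩ := Finset.exists_ne_zero_of_sum_ne_zero he
        rw [Finset.HasAntidiagonal.mem_antidiagonal] at hpq
        have h1 := ih g hg p (left_ne_zero_of_mul hne)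
        obtain ⟨i, hi, hqi⟩ := mem_varIdeal.1 hh q (right_ne_zero_of_mul hne)
        have h2 : q i ≤ ∑ i ∈ s, q i := Finset.single_le_sum (fun _ _ => Nat.zero_le _) hi
        rw [← hpq]
        simp only [Finsupp.add_apply, Finset.sum_add_distrib]
        omega
      · intro g h hg hh e he
        by_cases hge : g.coeff e = 0
        · exact hh e fun hhe => he (by rw [MvPolynomial.coeff_add, hge, hhe, add_zero])
        · exact hg e hge
  · intro h
    rw [f.as_sum]
    refine sum_mem fun e he => ?_
    have hle := h e (MvPolynomial.mem_support_iff.1 he)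
    rw [MvPolynomial.monomial_eq, Finsupp.prod_fintype _ _ (fun _ => pow_zero _),
      ← Finset.prod_mul_prod_compl s]
    refine Ideal.mul_mem_left _ _ (Ideal.mul_mem_right _ _ (Ideal.pow_le_pow_right hle ?_))
    rw [← Finset.prod_pow_eq_pow_sum]
    exact Ideal.prod_mem_prod fun i hi =>
      Ideal.pow_mem_pow (Ideal.subset_span (Set.mem_image_of_mem _ hi)) _

theorem mem_starIdeal {f : MvPolynomial (Fin n) 𝕜} :
    f ∈ starIdeal 𝕜 n c m ↔ ∀ e : Fin n →₀ ℕ, f.coeff e ≠ 0 → IsStarExponent c m e := by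
  simp only [starIdeal, Submodule.mem_iInf, mem_span_X_pow, Set.mem_ofPred_eq, IsStarExponent]
  exact ⟨fun h e he s hs => h s hs e he, fun h s hs e he => h e he s hs⟩

theorem starIdeal_eq (hc : 1 ≤ c) (hcn : c ≤ n) (hm : 1 ≤ m) :
    starIdeal 𝕜 n c m = monomialIdeal 𝕜 (gens n c m) := by
  ext f
  rw [mem_starIdeal, mem_monomialIdeal]
  refine forall₂_congr fun e _ => ⟨exists_gen_le hc hcn hm, ?_⟩
  rintro ⟨a, ha, hae⟩ s hs
  exact ((mem_gens.1 ha).isStarExponent s hs).trans (Finset.sum_le_sum fun i _ => hae i)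

theorem gradedBetti_starIdeal (hc : 1 ≤ c) (hcn : c ≤ n) (hm : 1 ≤ m) (i j : ℕ) :
    gradedBetti (starIdeal 𝕜 n c m) i j =
      ∑ a ∈ gens n c m, if j = i + a.degree then (colonVars a).card.choose i else 0 := by
  rw [starIdeal_eq hc hcn hm, gradedBetti_eq (I := monomialIdeal 𝕜 (gens n c m)) ?_
    (hasBetti_monomialIdeal (gens n c m) genKey colonVars ?_ ?_ ?_)]
  · refine Finset.sum_congr rfl fun a _ => ?_
    simp only [← Nat.cast_add, Nat.cast_inj]
  · intro f hf p
    refine mem_monomialIdeal.2 fun e he => mem_monomialIdeal.1 hf e fun h0 => he ?_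
    rw [MvPolynomial.coeff_homogeneousComponent, h0, ite_self]
  · exact fun a ha l hl => exists_genKey_lt ha hl
  · exact fun a ha b hb => exists_lt_of_genKey_le ha hb
  · intro a ha b hb hkey
    rw [degree_gen ha, degree_gen hb]
    exact add_le_add_right (Nat.mul_le_mul_left _ (maxVal_le_of_genKey_le hkey)) _

theorem gradedBetti_starIdeal_ne_zero_iff (hc : 1 ≤ c) (hcn : c ≤ n) (hm : 1 ≤ m) {i j : ℕ} :
    gradedBetti (starIdeal 𝕜 n c m) i j ≠ 0 ↔
      ∃ a ∈ gens n c m, j = i + (m + (n - c) * maxVal a) ∧ i ≤ (colonVars a).card := by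
  rw [gradedBetti_starIdeal hc hcn hm, ne_eq, Finset.sum_eq_zero_iff]
  push Not
  refine exists_congr fun a => and_congr_right fun ha => ?_
  rw [degree_gen ha]
  constructor
  · intro h
    split_ifs at h with hj
    · exact ⟨hj, by by_contra hlt; exact h (Nat.choose_eq_zero_of_lt (not_le.1 hlt))⟩
    · exact absurd rfl h
  · rintro ⟨hj, hi⟩
    rw [if_pos hj]
    exact (Nat.choose_pos hi).ne'

theorem gradedBetti_starIdeal_row (hc : 1 ≤ c) (hcn : c < n) (hm : 1 ≤ m) (i k : ℕ) :
    gradedBetti (starIdeal 𝕜 n c m) i (i + (m + k * (n - c))) =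
      ∑ a ∈ (gens n c m).filter (fun a => maxVal a = k), (colonVars a).card.choose i := by
  rw [gradedBetti_starIdeal hc hcn.le hm, Finset.sum_filter]
  refine Finset.sum_congr rfl fun a ha => ?_
  rw [degree_gen ha]
  have hpos : 0 < n - c := by omega
  have : i + (m + k * (n - c)) = i + (m + (n - c) * maxVal a) ↔ maxVal a = k := by
    rw [add_right_inj, add_right_inj, mul_comm, Nat.mul_right_inj hpos.ne']
    exact eq_comm
  simp only [this]

/-! ### Sizes of the colon sets. -/

theorem IsGen.card_filter_ne (hcn : c ≤ n) {k : ℕ} {a : Fin n →₀ ℕ} (ha : IsGen n c m k a) :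
    (Finset.univ.filter fun i => a i ≠ k).card ≤ c - 1 := by
  have h1 := ha.2.1
  have h2 := Finset.card_filter_add_card_filter_not (s := (Finset.univ : Finset (Fin n)))
    (fun i => a i = k)
  rw [Finset.card_univ, Fintype.card_fin] at h2
  simp only [ne_eq]
  omega

theorem colonVars_subset (a : Fin n →₀ ℕ) :
    colonVars a ⊆ Finset.univ.filter fun i => a i ≠ maxVal a := by
  intro i hi
  rw [colonVars, Finset.mem_filter] at hi
  rw [Finset.mem_filter]
  refine ⟨hi.1, ?_⟩
  rcases hi.2 with h | h <;> omega

theorem card_colonVars_le (hcn : c ≤ n) {a : Fin n →₀ ℕ} (ha : a ∈ gens n c m) :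
    (colonVars a).card ≤ c - 1 :=
  (Finset.card_le_card (colonVars_subset a)).trans ((mem_gens.1 ha).card_filter_ne hcn)

theorem IsGen.card_eq_of_large {k : ℕ} {a : Fin n →₀ ℕ} (ha : IsGen n c m k a)
    (hk : m < 2 * k) : (Finset.univ.filter fun i => a i = k).card = n - c + 1 := by
  refine le_antisymm ?_ ha.2.1
  by_contra! hlt
  have h1 := ha.mul_le
  have h2 := Nat.mul_le_mul_right k (Nat.succ_le_of_lt hlt)
  rw [Nat.succ_eq_add_one, add_mul, add_mul] at h2
  omega

/-- The maximal entries already use at least `(n - c + 1) * k` of the total `m + (n - c) * k`, which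
leaves at most `m - k` for the others. -/
theorem IsGen.add_le {k : ℕ} {a : Fin n →₀ ℕ} (ha : IsGen n c m k a) {i : Fin n}
    (hi : a i ≠ k) : a i + k ≤ m := by
  have h1 : ∑ i ∈ insert i (Finset.univ.filter fun i => a i = k), a i ≤ m + (n - c) * k :=
    ha.2.2 ▸ Finset.sum_le_sum_of_subset (Finset.subset_univ _)
  rw [Finset.sum_insert (by simpa using hi),
    Finset.sum_congr rfl fun i hi => (Finset.mem_filter.1 hi).2, Finset.sum_const,
    smul_eq_mul] at h1
  have h2 := Nat.mul_le_mul_right k ha.2.1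
  rw [add_mul, one_mul] at h2
  omega

theorem card_colonVars_of_large (hc : 1 ≤ c) (hcn : c ≤ n) {a : Fin n →₀ ℕ}
    (ha : a ∈ gens n c m) (hk : m + 2 ≤ 2 * maxVal a) : (colonVars a).card = c - 1 := by
  rw [mem_gens] at ha
  have hM := ha.card_eq_of_large (by omega)
  have h2 := Finset.card_filter_add_card_filter_not (s := (Finset.univ : Finset (Fin n)))
    (fun i => a i = maxVal a)
  rw [Finset.card_univ, Fintype.card_fin, hM] at h2
  have : colonVars a = Finset.univ.filter fun i => ¬ a i = maxVal a := by
    refine Finset.Subset.antisymm (colonVars_subset a) fun i hi => ?_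
    rw [Finset.mem_filter] at hi
    rw [colonVars, Finset.mem_filter]
    have := ha.add_le hi.2
    exact ⟨hi.1, Or.inl (by omega)⟩
  rw [this]
  omega

/-- The exponent with value `0` on `s` and `k` outside of `s`. -/
noncomputable def offExponent (k : ℕ) (s : Finset (Fin n)) : Fin n →₀ ℕ :=
  Finsupp.equivFunOnFinite.symm fun i => if i ∈ s then 0 else k

theorem offExponent_apply (k : ℕ) (s : Finset (Fin n)) (i : Fin n) :
    offExponent k s i = if i ∈ s then 0 else k := rfl

theorem filter_offExponent_eq {k : ℕ} (hk : 1 ≤ k) (s : Finset (Fin n)) :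
    (Finset.univ.filter fun i => offExponent k s i = k) = sᶜ := by
  ext i
  rw [Finset.mem_filter, Finset.mem_compl, offExponent_apply]
  split_ifs with h <;> simp [h]
  omega

theorem sum_offExponent (k : ℕ) (s : Finset (Fin n)) :
    ∑ i, offExponent k s i = (n - s.card) * k := by
  simp only [offExponent_apply]
  rw [Finset.sum_ite, Finset.sum_const_zero, zero_add, Finset.sum_const, smul_eq_mul]
  have h : (Finset.univ.filter fun i => i ∉ s) = sᶜ := by
    ext i
    simp
  rw [h, Finset.card_compl, Fintype.card_fin]

theorem isGen_offExponent {k : ℕ} (hk : 1 ≤ k) {s : Finset (Fin n)} (hs : n - c + 1 + s.card ≤ n)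
    (hsum : (n - s.card) * k = m + (n - c) * k) : IsGen n c m k (offExponent k s) := by
  refine ⟨fun i => ?_, ?_, ?_⟩
  · rw [offExponent_apply]
    split_ifs <;> omega
  · rw [filter_offExponent_eq hk, Finset.card_compl, Fintype.card_fin]
    omega
  · rw [sum_offExponent, hsum]

/-! ### Generators of largest exponent `m` and the bottom row. -/

theorem isGen_offExponent_max (hc : 1 ≤ c) (hcn : c ≤ n) (hm : 1 ≤ m) {s : Finset (Fin n)}
    (hs : s.card = c - 1) : IsGen n c m m (offExponent m s) := by
  refine isGen_offExponent hm (by omega) ?_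
  rw [hs, show n - (c - 1) = n - c + 1 by omega, add_mul, one_mul, add_comm]

theorem offExponent_injective {k : ℕ} (hk : 1 ≤ k) :
    Function.Injective (offExponent k : Finset (Fin n) → Fin n →₀ ℕ) := by
  intro s t hst
  rw [← compl_inj_iff, ← filter_offExponent_eq hk s, hst, filter_offExponent_eq hk]

theorem eq_offExponent {k : ℕ} {a : Fin n →₀ ℕ} (h : ∀ i, a i = 0 ∨ a i = k) :
    a = offExponent k (Finset.univ.filter fun i => a i ≠ k) := by
  ext i
  rw [offExponent_apply]
  rcases h i with h | h
  · split_ifs with hi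
    · exact h
    · simpa using hi
  · simp [h]

theorem filter_gens_max (hc : 1 ≤ c) (hcn : c ≤ n) (hm : 1 ≤ m) :
    (gens n c m).filter (fun a => maxVal a = m) =
      (Finset.powersetCard (c - 1) Finset.univ).map ⟨offExponent m, offExponent_injective hm⟩ := by
  ext a
  rw [Finset.mem_filter, Finset.mem_map]
  constructor
  · rintro ⟨ha, hk⟩
    rw [mem_gens, hk] at ha
    refine ⟨Finset.univ.filter fun i => a i ≠ m, ?_, (eq_offExponent fun i => ?_).symm⟩
    · rw [Finset.mem_powersetCard]
      refine ⟨Finset.subset_univ _, ?_⟩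
      have h2 := Finset.card_filter_add_card_filter_not (s := (Finset.univ : Finset (Fin n)))
        (fun i => a i = m)
      rw [Finset.card_univ, Fintype.card_fin, ha.card_eq_of_large (by omega)] at h2
      simp only [ne_eq]
      omega
    · by_cases hi : a i = m
      · exact Or.inr hi
      · have := ha.add_le hi
        exact Or.inl (by omega)
  · rintro ⟨s, hs, rfl⟩
    have := isGen_offExponent_max hc hcn hm (Finset.mem_powersetCard.1 hs).2
    exact ⟨this.mem_gens, this.maxVal_eq⟩

theorem card_filter_gens_max (hc : 1 ≤ c) (hcn : c ≤ n) (hm : 1 ≤ m) :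
    ((gens n c m).filter (fun a => maxVal a = m)).card = n.choose (c - 1) := by
  rw [filter_gens_max hc hcn hm, Finset.card_map, Finset.card_powersetCard, Finset.card_univ,
    Fintype.card_fin]

/-! ### Squarefree generators and the top row. -/

theorem filter_gens_one (hm : 1 ≤ m) (hmc : m ≤ c) (hcn : c ≤ n) :
    (gens n c m).filter (fun a => maxVal a = 1) =
      (Finset.powersetCard (m + n - c) Finset.univ).map
        ⟨fun s => offExponent 1 sᶜ, (offExponent_injective le_rfl).comp compl_injective⟩ := by
  ext a
  rw [Finset.mem_filter, Finset.mem_map]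
  constructor
  · rintro ⟨ha, hk⟩
    rw [mem_gens, hk] at ha
    have h01 : ∀ i, a i = 0 ∨ a i = 1 := fun i => by have := ha.1 i; omega
    refine ⟨(Finset.univ.filter fun i => a i ≠ 1)ᶜ, ?_, ?_⟩
    · rw [Finset.mem_powersetCard, Finset.card_compl, Fintype.card_fin]
      refine ⟨Finset.subset_univ _, ?_⟩
      have h1 := ha.2.2
      rw [eq_offExponent h01, sum_offExponent] at h1
      omega
    · rw [Function.Embedding.coeFn_mk, compl_compl]
      exact (eq_offExponent h01).symm
  · rintro ⟨s, hs, rfl⟩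
    rw [Finset.mem_powersetCard] at hs
    have : IsGen n c m 1 (offExponent 1 sᶜ) := by
      refine isGen_offExponent le_rfl ?_ ?_ <;>
      · rw [Finset.card_compl, Fintype.card_fin]
        omega
    exact ⟨this.mem_gens, this.maxVal_eq⟩

/-- The elements outside of `T` which are smaller than the largest element of `T`. -/
def gaps (T : Finset (Fin n)) : Finset (Fin n) :=
  Finset.univ.filter fun i => i ∉ T ∧ ∃ j ∈ T, i < j

theorem colonVars_offExponent_one (T : Finset (Fin n)) (hT : IsGen n c m 1 (offExponent 1 Tᶜ)) :
    colonVars (offExponent 1 Tᶜ) = gaps T := by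
  ext i
  rw [colonVars, gaps, Finset.mem_filter, Finset.mem_filter, hT.maxVal_eq]
  simp only [offExponent_apply, Finset.mem_compl]
  by_cases hi : i ∈ T <;> simp [hi, and_comm]

theorem card_filter_exists_lt {U : Finset (Fin n)} (hU : U.Nonempty) :
    (U.filter fun i => ∃ j ∈ U, i < j).card = U.card - 1 := by
  have : (U.filter fun i => ∃ j ∈ U, i < j) = U.erase (U.max' hU) := by
    ext i
    rw [Finset.mem_filter, Finset.mem_erase]
    constructor
    · rintro ⟨hi, j, hj, hij⟩
      exact ⟨(hij.trans_le (U.le_max' j hj)).ne, hi⟩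
    · rintro ⟨hne, hi⟩
      exact ⟨hi, _, U.max'_mem hU, lt_of_le_of_ne (U.le_max' i hi) hne⟩
  rw [this, Finset.card_erase_of_mem (U.max'_mem hU)]

/-- Both sides count pairs of sets. A `t`-set `T` with an `i`-subset `Q` of its gaps corresponds to
`U = T ∪ Q` with `Q`, where `Q` is any `i`-subset of `U` avoiding the largest element, because that
element must belong to `T`. -/
theorem sum_choose_card_gaps {t : ℕ} (ht : 1 ≤ t) (i : ℕ) :
    ∑ T ∈ Finset.powersetCard t (Finset.univ : Finset (Fin n)), (gaps T).card.choose i =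
      n.choose (t + i) * (t + i - 1).choose i := by
  have h1 : ∑ T ∈ Finset.powersetCard t (Finset.univ : Finset (Fin n)), (gaps T).card.choose i =
      ((Finset.powersetCard t (Finset.univ : Finset (Fin n))).sigma
        fun T => Finset.powersetCard i (gaps T)).card := by
    rw [Finset.card_sigma]
    exact Finset.sum_congr rfl fun T _ => (Finset.card_powersetCard _ _).symm
  have h2 : n.choose (t + i) * (t + i - 1).choose i =
      ((Finset.powersetCard (t + i) (Finset.univ : Finset (Fin n))).sigma
        fun U => Finset.powersetCard i (U.filter fun i => ∃ j ∈ U, i < j)).card := by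
    rw [Finset.card_sigma, Finset.sum_congr rfl fun U hU => ?_, Finset.sum_const,
      Finset.card_powersetCard, Finset.card_univ, Fintype.card_fin, smul_eq_mul]
    have hU' := (Finset.mem_powersetCard.1 hU).2
    rw [Finset.card_powersetCard, card_filter_exists_lt (Finset.card_pos.1 (by omega)), hU']
  rw [h1, h2]
  refine Finset.card_nbij' (fun p => ⟨p.1 ∪ p.2, p.2⟩) (fun p => ⟨p.1 \ p.2, p.2⟩) ?_ ?_ ?_ ?_
  · rintro ⟨T, Q⟩ h
    simp only [Finset.coe_sigma, Set.mem_sigma_iff, Finset.mem_coe, Finset.mem_powersetCard] at h ⊢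
    obtain ⟨⟨-, hT⟩, hQ, hQi⟩ := h
    have hdisj : Disjoint T Q := Finset.disjoint_right.2 fun q hq =>
      (Finset.mem_filter.1 (hQ hq)).2.1
    refine ⟨⟨Finset.subset_univ _, ?_⟩, fun q hq => ?_, hQi⟩
    · rw [Finset.card_union_of_disjoint hdisj, hT, hQi]
    · obtain ⟨j, hj, hqj⟩ := (Finset.mem_filter.1 (hQ hq)).2.2
      exact Finset.mem_filter.2 ⟨Finset.mem_union_right _ hq, j, Finset.mem_union_left _ hj, hqj⟩
  · rintro ⟨U, Q⟩ h
    simp only [Finset.coe_sigma, Set.mem_sigma_iff, Finset.mem_coe, Finset.mem_powersetCard] at h ⊢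
    obtain ⟨⟨-, hU⟩, hQ, hQi⟩ := h
    have hsub : Q ⊆ U := hQ.trans (Finset.filter_subset _ _)
    have hne : U.Nonempty := Finset.card_pos.1 (by omega)
    refine ⟨⟨Finset.subset_univ _, ?_⟩, fun q hq => ?_, hQi⟩
    · rw [Finset.card_sdiff_of_subset hsub]
      omega
    · obtain ⟨j, hj, hqj⟩ := (Finset.mem_filter.1 (hQ hq)).2
      refine Finset.mem_filter.2 ⟨Finset.mem_univ _, fun h => (Finset.mem_sdiff.1 h).2 hq,
        U.max' hne, Finset.mem_sdiff.2 ⟨U.max'_mem hne, fun hmax => ?_⟩,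
        hqj.trans_le (U.le_max' j hj)⟩
      obtain ⟨j', hj', hlt⟩ := (Finset.mem_filter.1 (hQ hmax)).2
      exact absurd (U.le_max' j' hj') (not_le.2 hlt)
  · rintro ⟨T, Q⟩ h
    simp only [Finset.coe_sigma, Set.mem_sigma_iff, Finset.mem_coe, Finset.mem_powersetCard] at h
    have hdisj : Disjoint T Q := Finset.disjoint_right.2 fun q hq =>
      (Finset.mem_filter.1 (h.2.1 hq)).2.1
    simp only [Finset.union_sdiff_cancel_right hdisj]
  · rintro ⟨U, Q⟩ h
    simp only [Finset.coe_sigma, Set.mem_sigma_iff, Finset.mem_coe, Finset.mem_powersetCard] at h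
    simp only [Finset.sdiff_union_of_subset (h.2.1.trans (Finset.filter_subset _ _))]

/-! ### Generators with the largest possible colon set. -/

theorem exists_sum_eq {ι : Type*} [DecidableEq ι] (s : Finset ι) (B N : ℕ) (h : N ≤ s.card * B) :
    ∃ g : ι → ℕ, (∀ i, g i ≤ B) ∧ ∑ i ∈ s, g i = N := by
  induction s using Finset.induction_on generalizing N with
  | empty => exact ⟨fun _ => 0, fun _ => Nat.zero_le _, by simpa [eq_comm] using h⟩
  | insert x s hx ih =>
    rw [Finset.card_insert_of_notMem hx, add_mul, one_mul] at h
    obtain ⟨g, hg, hsum⟩ := ih (N - min N B) (by omega)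
    refine ⟨Function.update g x (min N B), fun i => ?_, ?_⟩
    · by_cases hi : i = x
      · rw [hi, Function.update_self]; exact min_le_right _ _
      · rw [Function.update_of_ne hi]; exact hg i
    · rw [Finset.sum_insert hx, Function.update_self, Finset.sum_congr rfl fun i hi =>
        Function.update_of_ne (ne_of_mem_of_not_mem hi hx) _ _, hsum]
      omega

theorem exists_card_colonVars_eq (hc : 1 ≤ c) (hcn : c ≤ n) {k : ℕ} (hk : 1 ≤ k) (hkm : k ≤ m)
    (hmk : m ≤ c * (k - 1)) :
    ∃ a ∈ gens n c m, maxVal a = k ∧ (colonVars a).card = c - 1 := by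
  -- An entry `k` in the last position turns every entry `k - 1` into a colon variable.
  let last : Fin n := ⟨n - 1, by omega⟩
  obtain ⟨s, hs, hcard⟩ := Finset.exists_subset_card_eq
    (s := (Finset.univ : Finset (Fin n)).erase last) (n := c - 1) (by
      rw [Finset.card_erase_of_mem (Finset.mem_univ _), Finset.card_univ, Fintype.card_fin]
      omega)
  have hlast : last ∉ s := fun h => (Finset.mem_erase.1 (hs h)).1 rfl
  -- The `c - 1` entries on `s` must sum to `m - k` and stay below `k`. This needs `m - k ≤ (c - 1)
  -- * (k - 1)`, which follows from `m ≤ c * (k - 1)`.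
  obtain ⟨g, hg, hsum⟩ := exists_sum_eq s (k - 1) (m - k) (by
    rw [hcard]
    obtain ⟨c, rfl⟩ : ∃ c', c = c' + 1 := ⟨c - 1, by omega⟩
    rw [add_mul, one_mul] at hmk
    rw [Nat.add_sub_cancel]
    omega)
  let a : Fin n →₀ ℕ := Finsupp.equivFunOnFinite.symm fun i => if i ∈ s then g i else k
  have ha : ∀ i, a i = if i ∈ s then g i else k := fun i => rfl
  have hM : (Finset.univ.filter fun i => a i = k) = sᶜ := by
    ext i
    rw [Finset.mem_filter, Finset.mem_compl, ha]
    have := hg i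
    split_ifs with h <;> simp [h]
    omega
  have hgen : IsGen n c m k a := by
    refine ⟨fun i => ?_, ?_, ?_⟩
    · rw [ha]
      have := hg i
      split_ifs <;> omega
    · rw [hM, Finset.card_compl, Fintype.card_fin]
      omega
    · rw [← Finset.sum_add_sum_compl s, Finset.sum_congr rfl fun i hi => (ha i).trans (if_pos hi),
        hsum, Finset.sum_congr rfl fun i hi => (ha i).trans (if_neg (Finset.mem_compl.1 hi)),
        Finset.sum_const, Finset.card_compl, Fintype.card_fin, hcard, smul_eq_mul,
        show n - (c - 1) = n - c + 1 by omega, add_mul, one_mul]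
      omega
  refine ⟨a, hgen.mem_gens, hgen.maxVal_eq, ?_⟩
  rw [← hcard]
  congr 1
  ext i
  rw [colonVars, Finset.mem_filter, hgen.maxVal_eq]
  constructor
  · rintro ⟨-, h⟩
    by_contra hi
    have : a i = k := (ha i).trans (if_neg hi)
    omega
  · intro hi
    have h1 : a i = g i := (ha i).trans (if_pos hi)
    have h2 := hg i
    have h3 : i < last := by
      have h4 : i ≠ last := ne_of_mem_of_not_mem hi hlast
      have h5 : (i : ℕ) ≠ n - 1 := fun h => h4 (Fin.ext h)
      exact Fin.lt_def.2 (show (i : ℕ) < n - 1 by have := i.2; omega)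
    refine ⟨Finset.mem_univ _, ?_⟩
    rcases Nat.lt_or_ge (a i + 1) k with h | h
    · exact Or.inl h
    · exact Or.inr ⟨by omega, last, h3, (ha last).trans (if_neg hlast)⟩

theorem IsGen.le_mul {k : ℕ} {a : Fin n →₀ ℕ} (hcn : c ≤ n) (ha : IsGen n c m k a) :
    m ≤ c * k := by
  have h1 := Finset.sum_le_card_nsmul Finset.univ a k fun i _ => ha.1 i
  rw [ha.2.2, Finset.card_univ, Fintype.card_fin, smul_eq_mul] at h1
  obtain ⟨q, rfl⟩ := exists_add_of_le hcn
  rw [Nat.add_sub_cancel_left, add_mul] at h1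
  omega

end StarIdeal

end StarConfiguration

/-! ### The five statements about the Betti table. -/

open StarConfiguration in
theorem corollary4p4 (𝕜 : Type u) [Field 𝕜] (n c m : ℕ) (hc : 1 ≤ c) (hcn : c ≤ n) (hm : 1 ≤ m) :
    -- (1) the nonzero strands
    (∀ i d : ℕ, (∀ k ∈ Finset.Icc 1 m, d ≠ i + (m + k * (n - c))) →
      gradedBetti (starIdeal 𝕜 n c m) i d = 0) ∧
    -- (2) the strands with k ≥ m/2 + 1
    (c < n → ∀ i k : ℕ, (m : ℚ) / 2 + 1 ≤ (k : ℚ) →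
      gradedBetti (starIdeal 𝕜 n c m) i (i + (m + k * (n - c))) =
        (c - 1).choose i * gradedBetti (starIdeal 𝕜 n c m) 0 (m + k * (n - c))) ∧
    -- (3) the regularity and the bottom row
    IsRegularity (starIdeal 𝕜 n c m) ((m : ℤ) * (1 + (n : ℤ) - (c : ℤ))) ∧
    (c < n → 2 ≤ m → ∀ i : ℕ,
      gradedBetti (starIdeal 𝕜 n c m) i (i + m * (1 + n - c)) =
        n.choose (c - 1) * (c - 1).choose i) ∧
    -- (4) the top row for m ≤ c; a binomial coefficient with negative lower index is zero
    (c < n → m ≤ c → ∀ i : ℕ,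
      gradedBetti (starIdeal 𝕜 n c m) i (i + (m + (n - c))) =
        if m + i ≤ c then n.choose (c - m - i) * (m + n - c + i - 1).choose i else 0) ∧
    -- (5) the lengths of the rows
    (∀ j : ℕ, RowNonzero (starIdeal 𝕜 n c m) j → ¬ IsTopRow (starIdeal 𝕜 n c m) j →
      RowHasLength (starIdeal 𝕜 n c m) j (c - 1)) := by
  have hlarge : c < n → ∀ i k : ℕ, m + 2 ≤ 2 * k →
      gradedBetti (starIdeal 𝕜 n c m) i (i + (m + k * (n - c))) =
        ((gens n c m).filter fun a => maxVal a = k).card * (c - 1).choose i := by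
    intro hcn' i k hk
    rw [gradedBetti_starIdeal_row hc hcn' hm, Finset.sum_congr rfl fun a ha => ?_,
      Finset.sum_const, smul_eq_mul]
    rw [Finset.mem_filter] at ha
    rw [card_colonVars_of_large hc hcn ha.1 (ha.2.symm ▸ hk)]
  refine ⟨?_, ?_, ?_, ?_, ?_, ?_⟩
  · intro i d hd
    by_contra hne
    obtain ⟨a, ha, hda, -⟩ := (gradedBetti_starIdeal_ne_zero_iff hc hcn hm).1 hne
    rw [mem_gens] at ha
    exact hd _ (Finset.mem_Icc.2 ⟨ha.pos hm, ha.le⟩) (by rw [hda, mul_comm])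
  · intro hcn' i k hk
    have hk' : m + 2 ≤ 2 * k := by
      have : (m : ℚ) + 2 ≤ 2 * k := by linarith
      exact_mod_cast this
    have h0 := hlarge hcn' 0 k hk'
    rw [zero_add, Nat.choose_zero_right, mul_one] at h0
    rw [hlarge hcn' i k hk', h0, mul_comm]
  · constructor
    · obtain ⟨s, -, hs⟩ := Finset.exists_subset_card_eq (s := (Finset.univ : Finset (Fin n)))
        (n := c - 1) (by rw [Finset.card_univ, Fintype.card_fin]; omega)
      have hgen := isGen_offExponent_max hc hcn hm hs
      refine ⟨0, 0 + (m + (n - c) * m), (gradedBetti_starIdeal_ne_zero_iff hc hcn hm).2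
        ⟨_, hgen.mem_gens, by rw [hgen.maxVal_eq], Nat.zero_le _⟩, ?_⟩
      push_cast [Nat.cast_sub hcn]
      ring
    · rintro _ ⟨i, j, hne, rfl⟩
      obtain ⟨a, ha, rfl, -⟩ := (gradedBetti_starIdeal_ne_zero_iff hc hcn hm).1 hne
      have hle : (n - c) * maxVal a ≤ (n - c) * m := Nat.mul_le_mul_left _ (mem_gens.1 ha).le
      have h1 : (m : ℤ) * (1 + n - c) = m + ((n - c : ℕ) : ℤ) * m := by
        push_cast [Nat.cast_sub hcn]
        ring
      rw [h1]
      push_cast only [Nat.cast_add]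
      have h2 : (((n - c) * maxVal a : ℕ) : ℤ) ≤ (((n - c) * m : ℕ) : ℤ) := by exact_mod_cast hle
      rw [Nat.cast_mul (n - c) m] at h2
      linarith
  · intro hcn' hm2 i
    rw [show m * (1 + n - c) = m + m * (n - c) by
      rw [show 1 + n - c = 1 + (n - c) by omega, mul_add, mul_one], hlarge hcn' i m (by omega),
      card_filter_gens_max hc hcn hm]
  · intro hcn' hmc i
    have h1 := gradedBetti_starIdeal_row (𝕜 := 𝕜) hc hcn' hm i 1
    rw [one_mul] at h1
    rw [h1, filter_gens_one hm hmc hcn, Finset.sum_map]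
    have h2 : ∀ T ∈ Finset.powersetCard (m + n - c) (Finset.univ : Finset (Fin n)),
        (colonVars (offExponent 1 Tᶜ)).card.choose i = (gaps T).card.choose i := by
      intro T hT
      rw [colonVars_offExponent_one (c := c) (m := m)]
      have hT' : offExponent 1 Tᶜ ∈ (gens n c m).filter (fun a => maxVal a = 1) := by
        rw [filter_gens_one hm hmc hcn]
        exact Finset.mem_map_of_mem _ hT
      rw [Finset.mem_filter, mem_gens] at hT'
      have h3 := hT'.1
      rwa [hT'.2] at h3
    rw [show ∑ T ∈ Finset.powersetCard (m + n - c) (Finset.univ : Finset (Fin n)),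
      (colonVars ((⟨fun s => offExponent 1 sᶜ,
        (offExponent_injective le_rfl).comp compl_injective⟩ : Finset (Fin n) ↪ _) T)).card.choose i
        = _ from Finset.sum_congr rfl h2, sum_choose_card_gaps (by omega)]
    -- The count has `n.choose (m + n - c + i)`; symmetry gives the lower index `c - m - i`, and
    -- beyond that range the upper index is exceeded.
    split_ifs with hle
    · rw [← Nat.choose_symm (show c - m - i ≤ n by omega)]
      congr 2
      omega
    · rw [Nat.choose_eq_zero_of_lt (by omega), zero_mul]
  · intro j hj htop
    obtain ⟨j', ⟨i', hi'⟩, hlt⟩ : ∃ j', RowNonzero (starIdeal 𝕜 n c m) j' ∧ j' < j := by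
      by_contra! h
      exact htop ⟨hj, fun j' hj' => h j' hj'⟩
    obtain ⟨i, hi⟩ := hj
    obtain ⟨a, ha, hja, -⟩ := (gradedBetti_starIdeal_ne_zero_iff hc hcn hm).1 hi
    obtain ⟨b, hb, hjb, -⟩ := (gradedBetti_starIdeal_ne_zero_iff hc hcn hm).1 hi'
    have hja' : j = m + (n - c) * maxVal a := by omega
    have hjb' : j' = m + (n - c) * maxVal b := by omega
    have hk : maxVal b < maxVal a := by
      by_contra! hle
      have := Nat.mul_le_mul_left (n - c) hle
      omega
    -- A generator in the earlier row has sum at most `n * maxVal b`, hence `m ≤ c * maxVal b`; this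
    -- is where the row not being the top one is used.
    have hmk : m ≤ c * (maxVal a - 1) :=
      ((mem_gens.1 hb).le_mul hcn).trans (Nat.mul_le_mul_left _ (by omega))
    obtain ⟨a', ha', hmax, hcard⟩ := exists_card_colonVars_eq hc hcn
      ((mem_gens.1 ha).pos hm) (mem_gens.1 ha).le hmk
    constructor
    · exact (gradedBetti_starIdeal_ne_zero_iff hc hcn hm).2
        ⟨a', ha', by rw [hmax, hja'], hcard.ge⟩
    · intro l hl
      obtain ⟨a'', ha'', -, hle⟩ := (gradedBetti_starIdeal_ne_zero_iff hc hcn hm).1 hl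
      exact hle.trans (card_colonVars_le hcn ha'')
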